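/- Let $\xi=(\xi_t)_{t\in\mathbb Z}$ be a centered stationary Gaussian sequence whose covariance function $\rho(k)=\mathbb E(\xi_0\xi_k)$ satisfies $\rho(0)=1$ and $$\rho(k)=L(|k|)\,|k|^{2H-2},\qquad k\in\mathbb Z\setminus\{0\},$$ where $H\in(\tfrac12,\tfrac34)$ and $L:(0,\infty)\to(0,\infty)$ is slowly varying at infinity in Zygmund's sense (for every $\delta>0$, $x^{\delta}L(x)$ is increasing and $x^{-\delta}L(x)$ is decreasing for $x$ large enough), and $\lambda\mapsto L(1/\lambda)$ is of bounded variation on $(a,\pi)$ for every $a>0$. Let $\theta\in(0,1)$, $X_0=0$ and $X_t=\theta X_{t-1}+\xi_t$ for $t\ge 1$. For $x\in(0,1)$ put $Y_t^{(x)}=\sum_{j\ge0}x^j\xi_{t-j}$ and $f(x)=\mathbb E\big[(Y_t^{(x)})^2\big]$ (which does not depend on $t$), and let $R(k)=\mathbb E\big[Y^{(\theta)}_0Y^{(\theta)}_k\big]$ for $k\in\mathbb Z$. Then $f$ is strictly increasing on $(0,1)$ and differentiable at $\theta$ with $f'(\theta)>0$, $\sum_{k\in\mathbb Z}R(k)^2<\infty$,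 and the estimator $$\tilde\theta_n=f^{-1}\Big(\frac1n\sum_{t=1}^nX_t^2\Big)$$ satisfies, as $n\to\infty$, $$\sqrt n\,(\tilde\theta_n-\theta)\ \xrightarrow{\ \text{law}\ }\ \mathcal N\Big(0,\frac{\sigma_H^2}{[f'(\theta)]^2}\Big),\qquad \sigma_H^2=2\sum_{k\in\mathbb Z}R(k)^2.$$ Here $f^{-1}$ is the inverse of $f$ on $f((0,1))$, extended outside $f((0,1))$ by an arbitrary measurable real function (the choice of which does not matter). -/

import Mathlib

open MeasureTheory ProbabilityTheory Filter Set

noncomputable section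

namespace AR1

/-- `L`, positive on `(0, ∞)`, is slowly varying at infinity in Zygmund's sense: for every `δ > 0`,
`x ^ δ * L x` is increasing and `x ^ (-δ) * L x` is decreasing for `x` large enough. -/
structure SlowlyVaryingZygmund (L : ℝ → ℝ) : Prop where
  pos : ∀ x : ℝ, 0 < x → 0 < L x
  monotone : ∀ δ : ℝ, 0 < δ → ∃ x₀ : ℝ, 0 < x₀ ∧ MonotoneOn (fun x => x ^ δ * L x) (Ioi x₀)
  antitone : ∀ δ : ℝ, 0 < δ → ∃ x₀ : ℝ, 0 < x₀ ∧ AntitoneOn (fun x => x ^ (-δ) * L x) (Ioi x₀)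

/-- The autocovariance function `k ↦ E[X_0 X_k]` of a centered stationary sequence. -/
def autocov {Ω : Type*} [MeasurableSpace Ω] (P : Measure Ω) (X : ℤ → Ω → ℝ) (k : ℤ) : ℝ :=
  ∫ ω, X 0 ω * X k ω ∂P

/-- A centered stationary Gaussian sequence indexed by `ℤ`. (For a Gaussian sequence, stationarity
of the mean and of the covariance is the same as strict stationarity.) -/
structure IsStationaryGaussian {Ω : Type*} [MeasurableSpace Ω] (P : Measure Ω)
    (ξ : ℤ → Ω → ℝ) : Prop where
  gaussian : IsGaussianProcess ξ P
  mean_zero : ∀ t : ℤ, ∫ ω, ξ t ω ∂P = 0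
  stationary : ∀ s t : ℤ, ∫ ω, ξ s ω * ξ t ω ∂P = autocov P ξ (t - s)

/-- The long memory hypothesis on a covariance function `ρ`, with Hurst index `H` and slowly
varying function `L`. -/
structure LongMemory (H : ℝ) (L : ℝ → ℝ) (ρ : ℤ → ℝ) : Prop where
  half_lt : 1 / 2 < H
  lt_one : H < 1
  slowlyVarying : SlowlyVaryingZygmund L
  boundedVariation : ∀ a : ℝ, 0 < a → BoundedVariationOn (fun x : ℝ => L (1 / x)) (Ioo a Real.pi)
  cov_zero : ρ 0 = 1
  cov_eq : ∀ k : ℤ, k ≠ 0 → ρ k = L |(k : ℝ)| * |(k : ℝ)| ^ (2 * H - 2)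

/-- The autoregressive process `X_t = θ X_{t-1} + ξ_t`, `t ≥ 1`, started at `X_0 = 0`. -/
def arProcess {Ω : Type*} (θ : ℝ) (ξ : ℤ → Ω → ℝ) : ℕ → Ω → ℝ
  | 0 => fun _ => 0
  | t + 1 => fun ω => θ * arProcess θ ξ t ω + ξ ((t : ℤ) + 1) ω

/-- The stationary solution `Y_t = ∑_{j ≥ 0} θ ^ j ξ_{t - j}` (for `|θ| < 1` and noise that is
bounded in `L¹` the series converges absolutely almost surely). -/
def stationarySolution {Ω : Type*} (θ : ℝ) (ξ : ℤ → Ω → ℝ) (t : ℤ) (ω : Ω) : ℝ :=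
  ∑' j : ℕ, θ ^ j * ξ (t - j) ω

/-- `f(θ) = E[Y_t²]`, the second moment of the stationary solution, as a function of `θ`. -/
def secondMoment {Ω : Type*} [MeasurableSpace Ω] (P : Measure Ω) (ξ : ℤ → Ω → ℝ) (θ : ℝ) : ℝ :=
  ∫ ω, (stationarySolution θ ξ 0 ω) ^ 2 ∂P

open scoped Classical in
/-- The inverse of `f` restricted to `(0, 1)`. It is defined on the range `f((0, 1))`; elsewhere it
is given the default value `d y`. -/
def inverseOnUnit (f d : ℝ → ℝ) (y : ℝ) : ℝ :=
  if y ∈ f '' Ioo 0 1 then Function.invFunOn f (Ioo 0 1) y else d y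

/-- The second moment estimator `f⁻¹((1/n) ∑_{t=1}^n X_t²)`, computed from the observations `X`,
with default values `d` outside the range of `f`. -/
def momentEstimator {Ω : Type*} (f d : ℝ → ℝ) (X : ℕ → Ω → ℝ) (n : ℕ) (ω : Ω) : ℝ :=
  inverseOnUnit f d ((1 / (n : ℝ)) * ∑ t ∈ Finset.Icc 1 n, (X t ω) ^ 2)

/-- `σ_H² = 2 ∑_{k ∈ ℤ} R(k)²`. -/
def asymptoticVariance (R : ℤ → ℝ) : ℝ :=
  2 * ∑' k : ℤ, (R k) ^ 2

end AR1

end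

/-! The vector (X_1, …, X_n) is centred Gaussian with a covariance matrix G_n. Diagonalising G_n
turns Σ X_t² − tr G_n, in law, into Σ λ_i (Z_i² − 1) with independent standard normal Z_i. Since Z²
− 1 has characteristic function exp(−u²) + o(u²), the sum divided by √n tends to N(0, 2S) as soon as
max |λ_i| = o(√n) and (1/n) Σ λ_i² → S (`tendstoInDistribution_sum_sq`).

Both conditions come from the entries of G_n. Because ρ > 0, these entries are nonnegative and
dominated by the stationary covariances R(j − i). By Gershgorin, |λ_i| is at most a row sum, hence
at most 2 Σ_{k<n} R(k), which is o(√n) by Cauchy–Schwarz once R is square summable. Also Σ λ_i² = Σ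
G_ij², whose average over n tends to Σ R(k)² by a Cesàro argument (`tendsto_sum_truncatedCov_sq`).
Square summability of ρ is exactly where H < 3/4 enters, and R inherits it as a weighted average of
shifts of ρ.

Starting from X_0 = 0 instead of stationarity shifts the trace by O(1), negligible against √n. On
(0,1), f is a power series in x with positive coefficients, so it is strictly increasing with
positive derivative; the delta method for its inverse concludes. -/

open scoped Topology Matrix

noncomputable section

namespace AR1

/-! ### Characteristic function of Z² − 1 and products of its dilates -/

/-- The fourth moment of the standard normal law. -/
lemma integral_pow_four_gaussianReal : ∫ x, x ^ 4 ∂(gaussianReal 0 1) = 3 := by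
  -- The moment is the fourth derivative at 0 of exp(t²/2). Each differentiation sends p·exp(t²/2)
  -- to (p' + t p)·exp(t²/2), giving p = 1, t, 1 + t², 3t + t³ in turn.
  have key : ∀ p p' : ℝ → ℝ, (∀ t, HasDerivAt p (p' t) t) →
      deriv (fun t => p t * Real.exp (t ^ 2 / 2)) =
        fun t => (p' t + t * p t) * Real.exp (t ^ 2 / 2) := by
    intro p p' hp
    funext t
    have h2 : HasDerivAt (fun t : ℝ => Real.exp (t ^ 2 / 2)) (Real.exp (t ^ 2 / 2) * t) t := by
      have h3 : HasDerivAt (fun t : ℝ => t ^ 2 / 2) t t := by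
        have := (hasDerivAt_pow 2 t).div_const 2
        simpa using this
      exact h3.exp
    rw [((hp t).fun_mul h2).deriv]
    ring
  have h := iteratedDeriv_mgf_zero (X := id) (μ := gaussianReal 0 1) (by simp) 4
  have h1 : mgf id (gaussianReal 0 1) = fun t => (1 : ℝ) * Real.exp (t ^ 2 / 2) := by
    rw [mgf_id_gaussianReal]; simp
  have e1 := key (fun _ => 1) (fun _ => 0) (fun t => hasDerivAt_const t 1)
  have e2 := key (fun t => t) (fun _ => 1) (fun t => hasDerivAt_id t)
  have e3 := key (fun t => 1 + t ^ 2) (fun t => 2 * t) (fun t => by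
    simpa using (hasDerivAt_pow 2 t).const_add 1)
  have e4 := key (fun t => 3 * t + t ^ 3) (fun t => 3 + 3 * t ^ 2) (fun t => by
    simpa using ((hasDerivAt_id t).const_mul 3).fun_add (hasDerivAt_pow 3 t))
  rw [h1, iteratedDeriv_eq_iterate] at h
  simp only [Function.iterate_succ, Function.iterate_zero, Function.comp, id] at h
  rw [e1] at h
  simp only [mul_one, zero_add] at h
  rw [e2] at h
  rw [show (fun t : ℝ => (1 + t * t) * Real.exp (t ^ 2 / 2))
    = fun t => (1 + t ^ 2) * Real.exp (t ^ 2 / 2) by funext t; ring, e3,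
    show (fun t : ℝ => (2 * t + t * (1 + t ^ 2)) * Real.exp (t ^ 2 / 2))
    = fun t => (3 * t + t ^ 3) * Real.exp (t ^ 2 / 2) by funext t; ring, e4] at h
  simpa using h.symm

lemma integral_sq_gaussianReal : ∫ x, x ^ 2 ∂(gaussianReal 0 1) = 1 := by
  have h := variance_fun_id_gaussianReal (μ := 0) (v := 1)
  rw [variance_eq_integral measurable_id'.aemeasurable] at h
  simpa using h

/-- The characteristic function of `Z ^ 2 - 1` for a standard normal variable `Z`. -/
def centeredSqCharFun (u : ℝ) : ℂ :=
  charFun ((gaussianReal 0 1).map (fun x : ℝ => x ^ 2 - 1)) u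

lemma norm_centeredSqCharFun_le (u : ℝ) : ‖centeredSqCharFun u‖ ≤ 1 := by
  have : IsProbabilityMeasure ((gaussianReal 0 1).map (fun x : ℝ => x ^ 2 - 1)) :=
    Measure.isProbabilityMeasure_map (by fun_prop)
  exact norm_charFun_le_one _

lemma integrable_pow_gaussianReal (n : ℕ) : Integrable (fun x : ℝ => x ^ n) (gaussianReal 0 1) := by
  have := (memLp_id_gaussianReal (μ := 0) (v := 1) n)
  simpa using (this.integrable_norm_pow' : Integrable _ _).mono (by fun_prop) (by simp)

/-- Second order behaviour at `0` of the characteristic function of `Z ^ 2 - 1`. -/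
lemma centeredSqCharFun_sub_exp_isLittleO :
    (fun u : ℝ => centeredSqCharFun u - Complex.exp (-(u : ℂ) ^ 2)) =o[𝓝 0] fun u => u ^ 2 := by
  have h2 : (0 : ℝ) < √2 := by positivity
  have hs : √2 ^ 2 = 2 := Real.sq_sqrt (by norm_num)
  -- The second order Taylor expansion is stated for unit variance, and Z² − 1 has variance 3 − 2 +
  -- 1 = 2; hence the factor 1/√2, undone by the substitution u ↦ √2 u.
  have hX : AEMeasurable (fun x : ℝ => (√2)⁻¹ * (x ^ 2 - 1)) (gaussianReal 0 1) := by fun_prop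
  have i2 := integrable_pow_gaussianReal 2
  have i4 := integrable_pow_gaussianReal 4
  have h := taylor_charFun_two hX ?_ ?_
  · have hlim : Tendsto (fun u : ℝ => √2 * u) (𝓝 0) (𝓝 0) := by
      have : Continuous (fun u : ℝ => √2 * u) := by fun_prop
      simpa using this.tendsto 0
    have h' := h.comp_tendsto hlim
    have e : ∀ u : ℝ, charFun ((gaussianReal 0 1).map (fun x : ℝ => (√2)⁻¹ * (x ^ 2 - 1))) (√2 * u)
        = centeredSqCharFun u := by
      intro u
      rw [centeredSqCharFun, charFun_map_mul_comp (by fun_prop)]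
      congr 1
      field_simp
    have h1 : (fun u : ℝ => centeredSqCharFun u - (1 - (u : ℂ) ^ 2)) =o[𝓝 0] fun u => u ^ 2 := by
      refine Asymptotics.IsLittleO.of_const_mul_right (c := √2 ^ 2) ?_
      refine (h'.congr (fun u => ?_) (fun u => ?_))
      · simp only [Function.comp, e]
        congr 2
        push_cast
        rw [mul_pow, ← Complex.ofReal_pow, hs]
        push_cast; ring
      · simp [Function.comp, mul_pow]
    have h3 : (fun u : ℝ => (1 - (u : ℂ) ^ 2) - Complex.exp (-(u : ℂ) ^ 2)) =o[𝓝 0]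
        fun u : ℝ => u ^ 2 := by
      have hd : HasDerivAt Complex.exp 1 0 := by simpa using Complex.hasDerivAt_exp 0
      have hd' := (hasDerivAt_iff_isLittleO.1 hd)
      have ht : Tendsto (fun u : ℝ => -(u : ℂ) ^ 2) (𝓝 0) (𝓝 0) := by
        have : Continuous (fun u : ℝ => -(u : ℂ) ^ 2) := by fun_prop
        simpa using this.tendsto 0
      have hc := (hd'.comp_tendsto ht).neg_left
      refine Asymptotics.IsLittleO.trans_isBigO (hc.congr_left fun u => ?_)
        (Asymptotics.isBigO_of_le _ fun u => ?_)
      · simp; ring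
      · simp
    simpa using h1.add h3
  · rw [integral_const_mul, integral_sub i2 (by simp), integral_sq_gaussianReal]; simp
  · have : (fun x : ℝ => (√2)⁻¹ * (x ^ 2 - 1)) ^ 2 = fun x : ℝ => 2⁻¹ * (x ^ 4 - 2 * x ^ 2 + 1) := by
      funext x
      simp only [Pi.pow_apply, mul_pow, inv_pow, hs]; ring
    rw [this, integral_const_mul, integral_add (by exact i4.sub (i2.const_mul 2)) (integrable_const _),
      integral_sub i4 (i2.const_mul 2), integral_const_mul, integral_pow_four_gaussianReal,
      integral_sq_gaussianReal]
    simp; norm_num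

lemma norm_prod_sub_prod_le {ι : Type*} (s : Finset ι) (a b : ι → ℂ) (ha : ∀ i, ‖a i‖ ≤ 1)
    (hb : ∀ i, ‖b i‖ ≤ 1) : ‖∏ i ∈ s, a i - ∏ i ∈ s, b i‖ ≤ ∑ i ∈ s, ‖a i - b i‖ := by
  classical
  induction s using Finset.induction_on with
  | empty => simp
  | insert i s hi ih =>
    rw [Finset.prod_insert hi, Finset.prod_insert hi, Finset.sum_insert hi]
    have e : a i * ∏ j ∈ s, a j - b i * ∏ j ∈ s, b j
        = (a i - b i) * ∏ j ∈ s, a j + b i * (∏ j ∈ s, a j - ∏ j ∈ s, b j) := by ring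
    rw [e]
    refine (norm_add_le _ _).trans (add_le_add ?_ ?_)
    · rw [norm_mul, norm_prod]
      exact mul_le_of_le_one_right (norm_nonneg _)
        (Finset.prod_le_one (fun _ _ => norm_nonneg _) fun j _ => ha j)
    · rw [norm_mul]
      exact (mul_le_of_le_one_left (norm_nonneg _) (hb i)).trans ih

/-- A product of characteristic functions of `l i * (Z ^ 2 - 1)` is asymptotically Gaussian when
`∑ l i ^ 2` converges and `max |l i|` tends to `0`. -/
lemma tendsto_prod_centeredSqCharFun {ι : ℕ → Type*} [∀ n, Fintype (ι n)] (l : ∀ n, ι n → ℝ)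
    (b : ℕ → ℝ) (hb : Tendsto b atTop (𝓝 0)) (hl : ∀ n i, |l n i| ≤ b n) (S : ℝ)
    (hS : Tendsto (fun n => ∑ i, l n i ^ 2) atTop (𝓝 S)) :
    Tendsto (fun n => ∏ i, centeredSqCharFun (l n i)) atTop (𝓝 (Complex.exp (-(S : ℂ)))) := by
  have hexp : ∀ n, ∏ i, Complex.exp (-(l n i : ℂ) ^ 2)
      = Complex.exp (-((∑ i, l n i ^ 2 : ℝ) : ℂ)) := by
    intro n; rw [← Complex.exp_sum]; push_cast; rw [Finset.sum_neg_distrib]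
  have h1 : Tendsto (fun n => ∏ i, Complex.exp (-(l n i : ℂ) ^ 2)) atTop
      (𝓝 (Complex.exp (-(S : ℂ)))) := by
    simp_rw [hexp]
    exact ((by fun_prop : Continuous fun x : ℝ => Complex.exp (-(x : ℂ))).tendsto S).comp hS
  have h2 : Tendsto (fun n => ∏ i, centeredSqCharFun (l n i) - ∏ i, Complex.exp (-(l n i : ℂ) ^ 2))
      atTop (𝓝 0) := by
    rw [Metric.tendsto_atTop]
    intro ε hε
    have hSb : ∀ᶠ n in atTop, ∑ i, l n i ^ 2 < |S| + 1 :=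
      hS.eventually_lt_const (by linarith [le_abs_self S])
    -- The total error is at most this constant times Σ l², which is eventually below |S| + 1.
    have hpos : 0 < ε / (|S| + 1) := by positivity
    have hlo := (Asymptotics.isLittleO_iff.1 centeredSqCharFun_sub_exp_isLittleO) hpos
    obtain ⟨δ, hδ, hδ'⟩ := Metric.eventually_nhds_iff.1 hlo
    have hbs : ∀ᶠ n in atTop, b n < δ := hb.eventually_lt_const hδ
    obtain ⟨N, hN⟩ := eventually_atTop.1 (hSb.and hbs)
    refine ⟨N, fun n hn => ?_⟩
    obtain ⟨hn1, hn2⟩ := hN n hn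
    rw [dist_zero_right]
    have hb1 : ∀ i, ‖Complex.exp (-(l n i : ℂ) ^ 2)‖ ≤ 1 := by
      intro i
      rw [Complex.norm_exp, ← Complex.ofReal_pow, ← Complex.ofReal_neg, Complex.ofReal_re]
      exact Real.exp_le_one_iff.2 (by nlinarith [sq_nonneg (l n i)])
    calc _ ≤ ∑ i, ‖centeredSqCharFun (l n i) - Complex.exp (-(l n i : ℂ) ^ 2)‖ :=
          norm_prod_sub_prod_le _ _ _ (fun i => norm_centeredSqCharFun_le _) hb1
      _ ≤ ∑ i, ε / (|S| + 1) * l n i ^ 2 := by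
          refine Finset.sum_le_sum fun i _ => ?_
          have := hδ' (y := l n i) (by rw [dist_zero_right]; exact (hl n i).trans_lt hn2)
          simpa using this
      _ = ε / (|S| + 1) * ∑ i, l n i ^ 2 := by rw [Finset.mul_sum]
      _ < ε / (|S| + 1) * (|S| + 1) := by gcongr
      _ = ε := by field_simp
  simpa using h2.add h1

/-! ### Spectral bounds and quadratic forms of Gaussian vectors -/

/-- Gershgorin: the eigenvalue lies in the disc of some row k, and centre plus radius make up the
full absolute row sum. -/
lemma eigenvalues_abs_le {ι : Type*} [Fintype ι] [DecidableEq ι] {G : Matrix ι ι ℝ}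
    (hG : G.IsHermitian) {b : ℝ} (hb : ∀ i, ∑ j, |G i j| ≤ b) (i : ι) :
    |hG.eigenvalues i| ≤ b := by
  have hev : Module.End.HasEigenvalue (Matrix.toLin' G) (hG.eigenvalues i) := by
    rw [Module.End.hasEigenvalue_iff_mem_spectrum, Matrix.spectrum_toLin']
    exact hG.eigenvalues_mem_spectrum_real i
  obtain ⟨k, hk⟩ := eigenvalue_mem_ball hev
  rw [Metric.mem_closedBall, Real.dist_eq] at hk
  have h1 : |hG.eigenvalues i| ≤ |hG.eigenvalues i - G k k| + |G k k| := by
    simpa using abs_add_le (hG.eigenvalues i - G k k) (G k k)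
  have h2 := Finset.add_sum_erase Finset.univ (fun j => |G k j|) (Finset.mem_univ k)
  simp only [Real.norm_eq_abs] at hk
  linarith [hb k]

/-- Both sides are tr(G²), by symmetry of G and invariance of the trace under conjugation. -/
lemma sum_eigenvalues_sq {ι : Type*} [Fintype ι] [DecidableEq ι] {G : Matrix ι ι ℝ}
    (hG : G.IsHermitian) : ∑ i, hG.eigenvalues i ^ 2 = ∑ i, ∑ j, G i j ^ 2 := by
  set U : Matrix ι ι ℝ := (hG.eigenvectorUnitary : Matrix ι ι ℝ) with hU
  have hUU : star U * U = 1 := Unitary.coe_star_mul_self _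
  have hD := hG.conjStarAlgAut_star_eigenvectorUnitary
  rw [Unitary.conjStarAlgAut_star_apply, ← hU] at hD
  have hUU' : U * star U = 1 := Unitary.coe_mul_star_self _
  have h1 : (G * G).trace = ∑ i, ∑ j, G i j ^ 2 := by
    simp only [Matrix.trace, Matrix.diag, Matrix.mul_apply]
    refine Finset.sum_congr rfl fun i _ => Finset.sum_congr rfl fun j _ => ?_
    rw [sq, ← hG.apply j i]; simp
  have h2 : (star U * G * U) * (star U * G * U) = star U * (G * G) * U := by
    calc _ = star U * G * (U * star U) * G * U := by simp only [Matrix.mul_assoc]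
      _ = _ := by rw [hUU']; simp only [Matrix.mul_assoc, Matrix.one_mul]
  have h3 : (star U * (G * G) * U).trace = (G * G).trace := by
    rw [Matrix.trace_mul_comm, ← Matrix.mul_assoc, hUU', Matrix.one_mul]
  rw [← h1, ← h3, ← h2, hD, Matrix.diagonal_mul_diagonal, Matrix.trace_diagonal]
  simp [sq]

lemma charFun_map_sq_sub_of_hasGaussianLaw {Ω : Type*} [MeasurableSpace Ω] {P : Measure Ω}
    {W : Ω → ℝ} (hW : HasGaussianLaw W P) (h0 : ∫ ω, W ω ∂P = 0) {l : ℝ}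
    (hl : ∫ ω, W ω ^ 2 ∂P = l) (t : ℝ) :
    charFun (P.map (fun ω => W ω ^ 2 - l)) t = centeredSqCharFun (t * l) := by
  have hl0 : 0 ≤ l := hl ▸ integral_nonneg fun ω => sq_nonneg _
  have hvar : Var[W; P] = l := by
    rw [variance_eq_integral hW.aemeasurable, h0]; simpa using hl
  have hmap : P.map W = (gaussianReal 0 1).map (fun x => √l * x) := by
    rw [hW.map_eq_gaussianReal, h0, hvar, gaussianReal_map_const_mul]
    congr 1
    · simp
    · ext; simp [Real.sq_sqrt hl0, hl0]
  have e1 : P.map (fun ω => W ω ^ 2 - l) = (P.map W).map (fun x => x ^ 2 - l) := by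
    rw [AEMeasurable.map_map_of_aemeasurable (by fun_prop) hW.aemeasurable]; rfl
  rw [e1, hmap, Measure.map_map (by fun_prop) (by fun_prop)]
  have e2 : ((fun x : ℝ => x ^ 2 - l) ∘ fun x => √l * x) = fun x => l * (x ^ 2 - 1) := by
    funext x
    simp only [Function.comp, mul_pow, Real.sq_sqrt hl0]; ring
  rw [e2, charFun_map_mul_comp (by fun_prop), centeredSqCharFun, mul_comm]

/-- The characteristic function of a centred quadratic form of a Gaussian vector, in terms of the
eigenvalues of its covariance matrix. -/
lemma charFun_map_sum_sq_sub_trace {Ω : Type*} [MeasurableSpace Ω] {P : Measure Ω}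
    {ι : Type*} [Fintype ι] [DecidableEq ι] {X : ι → Ω → ℝ}
    (hX : HasGaussianLaw (fun ω i => X i ω) P) (h0 : ∀ i, ∫ ω, X i ω ∂P = 0)
    {G : Matrix ι ι ℝ} (hG : G.IsHermitian) (hcov : ∀ i j, ∫ ω, X i ω * X j ω ∂P = G i j)
    (c t : ℝ) :
    charFun (P.map (fun ω => c * (∑ i, X i ω ^ 2 - ∑ i, G i i))) t
      = ∏ i, centeredSqCharFun (c * t * hG.eigenvalues i) := by
  have hprob : IsProbabilityMeasure P := hX.isProbabilityMeasure
  set U : Matrix ι ι ℝ := (hG.eigenvectorUnitary : Matrix ι ι ℝ) with hU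
  have hD := hG.conjStarAlgAut_star_eigenvectorUnitary
  rw [Unitary.conjStarAlgAut_star_apply, ← hU] at hD
  have hUU' : U * star U = 1 := Unitary.coe_mul_star_self _
  -- Rotating to the eigenbasis makes the coordinates uncorrelated, hence independent by joint
  -- Gaussianity, and preserves the sum of squares.
  let W : ι → Ω → ℝ := fun i ω => (Uᵀ *ᵥ (fun j => X j ω)) i
  have hW : HasGaussianLaw (fun ω i => W i ω) P :=
    hX.map_fun (Matrix.mulVecLin Uᵀ).toContinuousLinearMap
  have hWapp : ∀ i ω, W i ω = ∑ a, U a i * X a ω := fun i ω => by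
    simp [W, Matrix.mulVec, dotProduct]
  have hXint : ∀ i, Integrable (X i) P := fun i => (hX.eval i).integrable
  have hXX : ∀ i j, Integrable (fun ω => X i ω * X j ω) P := fun i j =>
    (hX.eval i).memLp_two.integrable_mul (hX.eval j).memLp_two
  have hW0 : ∀ i, ∫ ω, W i ω ∂P = 0 := by
    intro i
    simp_rw [hWapp]
    rw [integral_finsetSum _ fun a _ => (hXint a).const_mul _]
    simp [integral_const_mul, h0]
  have hWW : ∀ i j, ∫ ω, W i ω * W j ω ∂P = Matrix.diagonal hG.eigenvalues i j := by
    intro i j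
    have e : ∀ ω, W i ω * W j ω = ∑ a, ∑ b, (U a i * U b j) * (X a ω * X b ω) := by
      intro ω
      rw [hWapp, hWapp, Finset.sum_mul_sum]
      refine Finset.sum_congr rfl fun a _ => Finset.sum_congr rfl fun b _ => by ring
    simp_rw [e]
    rw [integral_finsetSum _ fun a _ => integrable_finsetSum _ fun b _ => (hXX a b).const_mul _]
    have : (Matrix.diagonal hG.eigenvalues) i j = (star U * G * U) i j := by
      rw [hD]; rfl
    rw [this, Matrix.mul_apply]
    simp only [Matrix.mul_apply, Finset.sum_mul]
    rw [Finset.sum_comm]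
    refine Finset.sum_congr rfl fun a _ => ?_
    rw [integral_finsetSum _ fun b _ => (hXX a b).const_mul _]
    refine Finset.sum_congr rfl fun b _ => ?_
    rw [integral_const_mul, hcov]
    simp [Matrix.star_apply]
    ring
  have hind : iIndepFun W P := hW.iIndepFun_of_covariance_eq_zero fun i j hij => by
    rw [covariance_eq_sub (hW.eval i).memLp_two (hW.eval j).memLp_two, hW0]
    simpa [hij] using hWW i j
  have hsq : ∀ i, ∫ ω, W i ω ^ 2 ∂P = hG.eigenvalues i := fun i => by
    simpa [sq] using hWW i i
  have hsum : ∀ ω, ∑ i, X i ω ^ 2 = ∑ i, W i ω ^ 2 := by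
    intro ω
    have h1 : (Uᵀ *ᵥ (fun j => X j ω)) ⬝ᵥ (Uᵀ *ᵥ (fun j => X j ω))
        = (fun j => X j ω) ⬝ᵥ (fun j => X j ω) := by
      rw [Matrix.dotProduct_mulVec, Matrix.vecMul_transpose, Matrix.mulVec_mulVec]
      have : U * Uᵀ = 1 := by simpa [Matrix.star_eq_conjTranspose] using hUU'
      rw [this, Matrix.one_mulVec]
    simpa [dotProduct, sq, W] using h1.symm
  have htr : ∑ i, G i i = ∑ i, hG.eigenvalues i := by
    simpa [Matrix.trace] using hG.trace_eq_sum_eigenvalues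
  have hmeas : ∀ i, AEMeasurable (fun ω => W i ω ^ 2 - hG.eigenvalues i) P := fun i =>
    ((hW.eval i).aemeasurable.pow_const 2).sub_const _
  have hind' : iIndepFun (fun i ω => W i ω ^ 2 - hG.eigenvalues i) P :=
    hind.comp (fun i x => x ^ 2 - hG.eigenvalues i) (fun i => by fun_prop)
  have e : (fun ω => c * (∑ i, X i ω ^ 2 - ∑ i, G i i))
      = fun ω => c * (∑ i, (W i ω ^ 2 - hG.eigenvalues i)) := by
    funext ω
    rw [hsum, htr, Finset.sum_sub_distrib]
  rw [e, charFun_map_mul_comp (Finset.aemeasurable_fun_sum _ fun i _ => hmeas i),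
    hind'.charFun_map_fun_sum_eq_prod hmeas, Finset.prod_apply]
  exact Finset.prod_congr rfl fun i _ =>
    charFun_map_sq_sub_of_hasGaussianLaw (hW.eval i) (hW0 i) (hsq i) _

/-- Central limit theorem for sums of squares of a triangular array of Gaussian vectors. -/
theorem tendstoInDistribution_sum_sq {Ω : Type*} [MeasurableSpace Ω] {P : Measure Ω}
    [IsProbabilityMeasure P] {X : ∀ n : ℕ, Fin n → Ω → ℝ}
    (hX : ∀ n, HasGaussianLaw (fun ω i => X n i ω) P) (h0 : ∀ n i, ∫ ω, X n i ω ∂P = 0)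
    {G : ∀ n : ℕ, Matrix (Fin n) (Fin n) ℝ}
    (hcov : ∀ n i j, ∫ ω, X n i ω * X n j ω ∂P = G n i j)
    {b : ℕ → ℝ} (hb : Tendsto (fun n : ℕ => (√(n : ℝ))⁻¹ * b n) atTop (𝓝 0))
    (hrow : ∀ n i, ∑ j, |G n i j| ≤ b n) {S : ℝ}
    (hS : Tendsto (fun n : ℕ => (n : ℝ)⁻¹ * ∑ i, ∑ j, G n i j ^ 2) atTop (𝓝 S)) :
    TendstoInDistribution (fun (n : ℕ) ω => (√(n : ℝ))⁻¹ * (∑ i, X n i ω ^ 2 - ∑ i, G n i i))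
      atTop (id : ℝ → ℝ) (fun _ => P) (gaussianReal 0 (2 * S).toNNReal) where
  forall_aemeasurable n := by
    have : ∀ i, AEMeasurable (X n i) P := fun i => ((hX n).eval i).aemeasurable
    fun_prop
  tendsto := by
    have hS0 : 0 ≤ S := ge_of_tendsto' hS fun n => by positivity
    have hG : ∀ n, (G n).IsHermitian := fun n => by
      ext i j
      rw [Matrix.conjTranspose_apply, ← hcov, ← hcov]
      simp [mul_comm]
    refine ProbabilityMeasure.tendsto_iff_tendsto_charFun.2 fun t => ?_
    simp only [ProbabilityMeasure.coe_mk, Measure.map_id, charFun_gaussianReal,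
      fun n => charFun_map_sum_sq_sub_trace (hX n) (h0 n) (hG n) (hcov n)]
    -- The limit exp(−t² S) is the characteristic function of N(0, 2S).
    have h := tendsto_prod_centeredSqCharFun
      (fun n i => (√(n : ℝ))⁻¹ * t * (hG n).eigenvalues i) (fun n => |t| * ((√(n : ℝ))⁻¹ * b n))
      (by simpa using hb.const_mul |t|) (fun n i => by
        rw [abs_mul, abs_mul, abs_inv, abs_of_nonneg (Real.sqrt_nonneg _)]
        have := eigenvalues_abs_le (hG n) (hrow n) i
        calc _ = |t| * ((√(n : ℝ))⁻¹ * |(hG n).eigenvalues i|) := by ring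
          _ ≤ _ := by gcongr) (t ^ 2 * S) (by
        refine (hS.const_mul (t ^ 2)).congr fun n => ?_
        simp only [mul_pow, inv_pow, Real.sq_sqrt (Nat.cast_nonneg n)]
        rw [← Finset.mul_sum, sum_eigenvalues_sq]; ring)
    convert h using 3
    rw [Real.coe_toNNReal _ (by positivity)]
    push_cast
    ring

/-! ### Covariances of the stationary and of the started process -/

/-- The autocovariance of `∑_{j ≥ 0} θ ^ j ξ_{t - j}`, in terms of the autocovariance `ρ` of `ξ`. -/
def filteredCov (θ : ℝ) (ρ : ℤ → ℝ) (k : ℤ) : ℝ :=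
  ∑' p : ℕ × ℕ, θ ^ p.1 * θ ^ p.2 * ρ (k + p.1 - p.2)

/-- The covariance of `∑_{i < s} θ ^ i ξ_{s - i}` and `∑_{j < t} θ ^ j ξ_{t - j}`. -/
def truncatedCov (θ : ℝ) (ρ : ℤ → ℝ) (s t : ℕ) : ℝ :=
  ∑ p ∈ Finset.range s ×ˢ Finset.range t, θ ^ p.1 * θ ^ p.2 * ρ ((t : ℤ) - s + p.1 - p.2)

section Covariance

variable {θ : ℝ} {ρ : ℤ → ℝ}

lemma hasSum_geometric_prod (hθ : θ ∈ Ioo (0 : ℝ) 1) :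
    HasSum (fun p : ℕ × ℕ => θ ^ p.1 * θ ^ p.2) ((1 - θ)⁻¹ * (1 - θ)⁻¹) := by
  have h := hasSum_geometric_of_lt_one hθ.1.le hθ.2
  refine h.mul h ?_
  exact h.summable.mul_of_nonneg h.summable (fun _ => pow_nonneg hθ.1.le _)
    fun _ => pow_nonneg hθ.1.le _

lemma geometric_prod_nonneg (hθ : θ ∈ Ioo (0 : ℝ) 1) (p : ℕ × ℕ) : 0 ≤ θ ^ p.1 * θ ^ p.2 :=
  mul_nonneg (pow_nonneg hθ.1.le _) (pow_nonneg hθ.1.le _)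

lemma summable_filteredCov (hθ : θ ∈ Ioo (0 : ℝ) 1) (h0 : ∀ k, 0 ≤ ρ k) (h1 : ∀ k, ρ k ≤ 1)
    (k : ℤ) : Summable fun p : ℕ × ℕ => θ ^ p.1 * θ ^ p.2 * ρ (k + p.1 - p.2) :=
  (hasSum_geometric_prod hθ).summable.of_nonneg_of_le
    (fun p => mul_nonneg (geometric_prod_nonneg hθ p) (h0 _))
    fun p => mul_le_of_le_one_right (geometric_prod_nonneg hθ p) (h1 _)

lemma filteredCov_nonneg (hθ : θ ∈ Ioo (0 : ℝ) 1) (h0 : ∀ k, 0 ≤ ρ k) (k : ℤ) :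
    0 ≤ filteredCov θ ρ k :=
  tsum_nonneg fun p => mul_nonneg (geometric_prod_nonneg hθ p) (h0 _)

lemma truncatedCov_nonneg (hθ : θ ∈ Ioo (0 : ℝ) 1) (h0 : ∀ k, 0 ≤ ρ k) (s t : ℕ) :
    0 ≤ truncatedCov θ ρ s t :=
  Finset.sum_nonneg fun p _ => mul_nonneg (geometric_prod_nonneg hθ p) (h0 _)

lemma truncatedCov_le (hθ : θ ∈ Ioo (0 : ℝ) 1) (h0 : ∀ k, 0 ≤ ρ k) (h1 : ∀ k, ρ k ≤ 1)
    (s t : ℕ) : truncatedCov θ ρ s t ≤ filteredCov θ ρ ((t : ℤ) - s) :=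
  (summable_filteredCov hθ h0 h1 _).sum_le_tsum _ fun p _ =>
    mul_nonneg (geometric_prod_nonneg hθ p) (h0 _)

/-- As ρ ≤ 1, the missing terms weigh at most the geometric mass outside the s × t rectangle: with C
= (1 − θ)⁻², this is C(1 − (1 − θ^s)(1 − θ^t)). -/
lemma filteredCov_sub_truncatedCov_le (hθ : θ ∈ Ioo (0 : ℝ) 1) (h0 : ∀ k, 0 ≤ ρ k)
    (h1 : ∀ k, ρ k ≤ 1) (s t : ℕ) :
    filteredCov θ ρ ((t : ℤ) - s) - truncatedCov θ ρ s t
      ≤ (θ ^ s + θ ^ t) * ((1 - θ)⁻¹ * (1 - θ)⁻¹) := by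
  have hs := (hasSum_geometric_prod hθ).sub (summable_filteredCov hθ h0 h1 ((t : ℤ) - s)).hasSum
  have hle := sum_le_hasSum (Finset.range s ×ˢ Finset.range t) (fun p _ => by
    have := mul_le_of_le_one_right (geometric_prod_nonneg hθ p) (h1 ((t : ℤ) - s + p.1 - p.2))
    linarith) hs
  rw [Finset.sum_sub_distrib] at hle
  have hgeom : ∑ p ∈ Finset.range s ×ˢ Finset.range t, θ ^ p.1 * θ ^ p.2
      = ((1 - θ ^ s) * (1 - θ)⁻¹) * ((1 - θ ^ t) * (1 - θ)⁻¹) := by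
    rw [Finset.sum_product, ← Finset.sum_mul_sum]
    have hne : θ ≠ 1 := hθ.2.ne
    have hne' : 1 - θ ≠ 0 := sub_ne_zero.2 hne.symm
    have hne'' : θ - 1 ≠ 0 := sub_ne_zero.2 hne
    rw [geom_sum_eq hne, geom_sum_eq hne]
    field_simp
    ring
  have hpos : 0 ≤ (1 - θ)⁻¹ * (1 - θ)⁻¹ := mul_self_nonneg _
  have hst : 0 ≤ θ ^ s * θ ^ t := geometric_prod_nonneg hθ (s, t)
  rw [hgeom] at hle
  change _ ≤ (1 - θ)⁻¹ * (1 - θ)⁻¹ - filteredCov θ ρ ((t : ℤ) - s) at hle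
  change (1 - θ ^ s) * (1 - θ)⁻¹ * ((1 - θ ^ t) * (1 - θ)⁻¹) - truncatedCov θ ρ s t ≤ _ at hle
  nlinarith [mul_nonneg hst hpos]

lemma filteredCov_neg (heven : ∀ k, ρ (-k) = ρ k) (k : ℤ) :
    filteredCov θ ρ (-k) = filteredCov θ ρ k := by
  unfold filteredCov
  rw [← (Equiv.prodComm ℕ ℕ).tsum_eq]
  refine tsum_congr fun p => ?_
  simp only [Equiv.prodComm_apply, Prod.fst_swap, Prod.snd_swap]
  rw [← heven, mul_comm (θ ^ p.2)]
  congr 2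
  ring

lemma truncatedCov_comm (heven : ∀ k, ρ (-k) = ρ k) (s t : ℕ) :
    truncatedCov θ ρ s t = truncatedCov θ ρ t s := by
  unfold truncatedCov
  rw [Finset.sum_product, Finset.sum_product_right]
  refine Finset.sum_congr rfl fun i _ => Finset.sum_congr rfl fun j _ => ?_
  rw [← heven, mul_comm (θ ^ i)]
  congr 2
  ring

/-- Jensen: R(k) is a sum of shifts of ρ with weights of total mass C, so R(k)² ≤ C Σ θ^(i+j)
ρ(k+i−j)². Summing over k first gives the finite bound C² Σ ρ². -/
lemma summable_filteredCov_sq (hθ : θ ∈ Ioo (0 : ℝ) 1) (h0 : ∀ k, 0 ≤ ρ k) (h1 : ∀ k, ρ k ≤ 1)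
    (hsq : Summable fun k => ρ k ^ 2) : Summable fun k => filteredCov θ ρ k ^ 2 := by
  set C : ℝ := (1 - θ)⁻¹ * (1 - θ)⁻¹ with hC
  have hCpos : 0 < C := by
    have : 0 < (1 - θ)⁻¹ := inv_pos.2 (sub_pos.2 hθ.2)
    positivity
  have hw := hasSum_geometric_prod hθ
  have hS : Summable fun q : (ℕ × ℕ) × ℤ =>
      θ ^ q.1.1 * θ ^ q.1.2 * ρ (q.2 + q.1.1 - q.1.2) ^ 2 := by
    have hsh : ∀ p : ℕ × ℕ, HasSum (fun k : ℤ => ρ (k + p.1 - p.2) ^ 2) (∑' k, ρ k ^ 2) := by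
      intro p
      have := (Equiv.addRight ((p.1 : ℤ) - p.2)).hasSum_iff.2 hsq.hasSum
      refine this.congr_fun fun k => ?_
      simp [add_sub_assoc]
    refine (summable_prod_of_nonneg fun q =>
      mul_nonneg (geometric_prod_nonneg hθ _) (sq_nonneg _)).2 ⟨fun p => ?_, ?_⟩
    · exact (hsh p).summable.mul_left (θ ^ p.1 * θ ^ p.2)
    · simp only [tsum_mul_left, fun p => (hsh p).tsum_eq]
      exact hw.summable.mul_right _
  refine (hS.prod_symm.prod.mul_left C).of_nonneg_of_le (fun k => sq_nonneg _) fun k => ?_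
  -- The weighted mean of the shifted ρ. Nonnegativity of the weighted variance about m is the
  -- required inequality.
  set m := filteredCov θ ρ k / C
  have hR := (summable_filteredCov hθ h0 h1 k).hasSum
  have hQ := (hS.prod_symm.prod_factor k).hasSum
  have hdev := (hQ.sub (hR.mul_left (2 * m))).add (hw.mul_left (m ^ 2))
  have hnn := hdev.nonneg fun p => by
    have := mul_nonneg (geometric_prod_nonneg hθ p) (sq_nonneg (ρ (k + p.1 - p.2) - m))
    simp only [Prod.swap]
    nlinarith
  change 0 ≤ _ - 2 * m * filteredCov θ ρ k + m ^ 2 * C at hnn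
  have hm : filteredCov θ ρ k = m * C := by simp only [m]; field_simp
  rw [hm] at hnn ⊢
  nlinarith

lemma tendsto_truncatedCov (hθ : θ ∈ Ioo (0 : ℝ) 1) (h0 : ∀ k, 0 ≤ ρ k) (h1 : ∀ k, ρ k ≤ 1)
    {s t : ℕ → ℕ} (hs : Tendsto s atTop atTop) (ht : Tendsto t atTop atTop) {k : ℤ}
    (hk : ∀ᶠ n in atTop, (t n : ℤ) - s n = k) :
    Tendsto (fun n => truncatedCov θ ρ (s n) (t n)) atTop (𝓝 (filteredCov θ ρ k)) := by
  have hp := tendsto_pow_atTop_nhds_zero_of_lt_one hθ.1.le hθ.2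
  have hlow : Tendsto (fun n => filteredCov θ ρ k
      - (θ ^ s n + θ ^ t n) * ((1 - θ)⁻¹ * (1 - θ)⁻¹)) atTop (𝓝 (filteredCov θ ρ k)) := by
    simpa using tendsto_const_nhds.sub
      (((hp.comp hs).add (hp.comp ht)).mul_const ((1 - θ)⁻¹ * (1 - θ)⁻¹))
  refine tendsto_of_tendsto_of_tendsto_of_le_of_le' hlow tendsto_const_nhds ?_ ?_
  · filter_upwards [hk] with n hn
    have := filteredCov_sub_truncatedCov_le hθ h0 h1 (s n) (t n)
    rw [hn] at this
    linarith
  · filter_upwards [hk] with n hn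
    have := truncatedCov_le hθ h0 h1 (s n) (t n)
    rwa [hn] at this

/-- Dominated convergence for series, after extending each finite sum by zero. -/
lemma tendsto_sum_range_of_dominated {h : ℕ → ℕ → ℝ} {B l : ℕ → ℝ} (hB : Summable B)
    {N : ℕ → ℕ} (hN : Tendsto N atTop atTop) (hbound : ∀ n k, k < N n → |h n k| ≤ B k)
    (hB0 : ∀ k, 0 ≤ B k) (hl : ∀ k, Tendsto (fun n => h n k) atTop (𝓝 (l k))) :
    Tendsto (fun n => ∑ k ∈ Finset.range (N n), h n k) atTop (𝓝 (∑' k, l k)) := by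
  have key := tendsto_tsum_of_dominated_convergence
    (f := fun n k => if k ∈ Finset.range (N n) then h n k else 0) (g := l) (𝓕 := atTop) hB
    (fun k => (hl k).congr' ?_) (Eventually.of_forall fun n k => ?_)
  · refine key.congr fun n => ?_
    rw [tsum_eq_sum (s := Finset.range (N n)) fun k hk => if_neg hk]
    exact Finset.sum_congr rfl fun k hk => if_pos hk
  · filter_upwards [hN.eventually_gt_atTop k] with n hn
    rw [if_pos (Finset.mem_range.2 hn)]
  · split_ifs with hk
    · exact hbound n k (Finset.mem_range.1 hk)
    · simpa using hB0 k

/-- The normalised sum of squared covariances converges to `∑_{k ∈ ℤ} R(k) ^ 2`. -/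
lemma tendsto_sum_truncatedCov_sq (hθ : θ ∈ Ioo (0 : ℝ) 1) (h0 : ∀ k, 0 ≤ ρ k)
    (h1 : ∀ k, ρ k ≤ 1) (heven : ∀ k, ρ (-k) = ρ k) (hsq : Summable fun k => ρ k ^ 2) :
    Tendsto (fun n : ℕ => (n : ℝ)⁻¹ *
      ∑ i ∈ Finset.range n, ∑ j ∈ Finset.range n, truncatedCov θ ρ (i + 1) (j + 1) ^ 2) atTop
      (𝓝 (∑' k, filteredCov θ ρ k ^ 2)) := by
  set g : ℕ → ℕ → ℝ := fun i j => truncatedCov θ ρ (i + 1) (j + 1) ^ 2 with hg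
  set R := filteredCov θ ρ with hR
  have hRs : Summable fun k => R k ^ 2 := summable_filteredCov_sq hθ h0 h1 hsq
  have hgs : ∀ i j, g i j = g j i := fun i j => by simp only [hg]; rw [truncatedCov_comm heven]
  have hgle : ∀ i j, |g i j| ≤ R ((j : ℤ) - i) ^ 2 := fun i j => by
    rw [abs_of_nonneg (sq_nonneg _)]
    have := truncatedCov_le hθ h0 h1 (i + 1) (j + 1)
    have e : ((j + 1 : ℕ) : ℤ) - ((i + 1 : ℕ) : ℤ) = j - i := by push_cast; ring
    rw [e] at this
    exact pow_le_pow_left₀ (truncatedCov_nonneg hθ h0 _ _) this 2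
  have hnat : Summable fun k : ℕ => R k ^ 2 :=
    hRs.comp_injective (i := fun k : ℕ => (k : ℤ)) Nat.cast_injective
  have hnat' : Summable fun k : ℕ => R (-(k + 1 : ℤ)) ^ 2 :=
    hRs.comp_injective (i := fun k : ℕ => -(k + 1 : ℤ)) fun a b h => by simpa using h
  -- Column n, diagonal included, read upwards from the diagonal: the lags are 0, 1, 2, …. In
  -- `lim2`, row n without its diagonal entry gives the lags −1, −2, ….
  have lim1 : Tendsto (fun n => ∑ i ∈ Finset.range (n + 1), g i n) atTop (𝓝 (∑' k : ℕ, R k ^ 2)) := by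
    simp_rw [← Finset.sum_range_reflect (fun i => g i _) (_ + 1)]
    refine tendsto_sum_range_of_dominated hnat (tendsto_add_atTop_nat 1) (fun n k hk => ?_)
      (fun k => sq_nonneg _) fun k => ?_
    · refine (hgle _ _).trans_eq ?_
      congr 2; omega
    · refine (tendsto_truncatedCov hθ h0 h1 ?_ (tendsto_add_atTop_nat 1) ?_).pow 2
      · exact tendsto_atTop_mono (fun n => by omega : ∀ n, n - k ≤ n + 1 - 1 - k + 1)
          (tendsto_sub_atTop_nat k)
      · filter_upwards [eventually_ge_atTop k] with n hn
        omega
  have lim2 : Tendsto (fun n => ∑ j ∈ Finset.range n, g n j) atTop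
      (𝓝 (∑' k : ℕ, R (-(k + 1 : ℤ)) ^ 2)) := by
    simp_rw [← Finset.sum_range_reflect (fun j => g _ j)]
    refine tendsto_sum_range_of_dominated hnat' tendsto_id (fun n k hk => ?_)
      (fun k => sq_nonneg _) fun k => ?_
    · refine (hgle _ _).trans_eq ?_
      congr 2; omega
    · refine (tendsto_truncatedCov hθ h0 h1 (tendsto_add_atTop_nat 1) ?_ ?_).pow 2
      · exact tendsto_atTop_mono (fun n => by omega : ∀ n, n - k ≤ n - 1 - k + 1)
          (tendsto_sub_atTop_nat k)
      · filter_upwards [eventually_gt_atTop k] with n hn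
        omega
  have hsum : ∑' k, R k ^ 2 = ∑' k : ℕ, R k ^ 2 + ∑' k : ℕ, R (-(k + 1 : ℤ)) ^ 2 :=
    tsum_of_nat_of_neg_add_one hnat hnat'
  rw [hsum]
  -- Passing from the n × n block to the next adds one such column and row, so the normalised double
  -- sum is a Cesàro mean of a convergent sequence.
  refine (lim1.add lim2).cesaro.congr fun n => ?_
  congr 1
  induction n with
  | zero => simp
  | succ n ih =>
    rw [Finset.sum_range_succ, ih, Finset.sum_range_succ (fun i => ∑ j ∈ Finset.range (n + 1), g i j)]
    simp_rw [Finset.sum_range_succ (fun j => g _ j) n]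
    rw [Finset.sum_add_distrib, Finset.sum_range_succ (fun i => g i n) n]
    ring

/-- A fixed head divided by √n vanishes; by Cauchy–Schwarz the rest is at most √n times the ℓ² norm
of the tail, which is small for a late cut K. -/
lemma tendsto_inv_sqrt_mul_sum_of_summable_sq {c : ℕ → ℝ} (hc : ∀ k, 0 ≤ c k)
    (hs : Summable fun k => c k ^ 2) :
    Tendsto (fun n : ℕ => (√(n : ℝ))⁻¹ * ∑ k ∈ Finset.range n, c k) atTop (𝓝 0) := by
  rw [Metric.tendsto_atTop]
  intro ε hε
  have htail : Tendsto (fun K => ∑' k, c (k + K) ^ 2) atTop (𝓝 0) :=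
    tendsto_sum_nat_add fun k => c k ^ 2
  obtain ⟨K, hK⟩ := (htail.eventually_lt_const (by positivity : (0 : ℝ) < (ε / 2) ^ 2)).exists
  set A := ∑ k ∈ Finset.range K, c k
  have hsq : Tendsto (fun n : ℕ => (√(n : ℝ))⁻¹ * A) atTop (𝓝 0) := by
    simpa using (tendsto_inv_atTop_zero.comp
      (Real.tendsto_sqrt_atTop.comp tendsto_natCast_atTop_atTop)).mul_const A
  obtain ⟨N, hN⟩ := eventually_atTop.1 (hsq.eventually_lt_const (by positivity : (0 : ℝ) < ε / 2))
  refine ⟨max N (K + 1), fun n hn => ?_⟩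
  have hnK : K ≤ n := by omega
  have hn0 : (0 : ℝ) < n := by exact_mod_cast (by omega : 0 < n)
  rw [Real.dist_0_eq_abs, abs_of_nonneg
    (mul_nonneg (by positivity) (Finset.sum_nonneg fun k _ => hc k))]
  obtain ⟨m, rfl⟩ := Nat.exists_eq_add_of_le hnK
  rw [Finset.sum_range_add, mul_add]
  have hA := hN (K + m) (le_trans (le_max_left _ _) hn)
  have hB : ∑ k ∈ Finset.range m, c (K + k) ≤ √((K + m : ℕ) : ℝ) * (ε / 2) := by
    refine abs_le_of_sq_le_sq' ?_ (by positivity) |>.2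
    have h1 := sq_sum_le_card_mul_sum_sq (s := Finset.range m) (f := fun k => c (K + k))
    have h2 : ∑ k ∈ Finset.range m, c (K + k) ^ 2 ≤ (ε / 2) ^ 2 := by
      have hsK : Summable fun k => c (K + k) ^ 2 := hs.comp_injective (add_right_injective K)
      refine (hsK.sum_le_tsum _ fun k _ => sq_nonneg _).trans (le_of_eq_of_le ?_ hK.le)
      · exact tsum_congr fun k => by rw [add_comm]
    rw [mul_pow, Real.sq_sqrt (Nat.cast_nonneg _)]
    refine h1.trans ?_
    rw [Finset.card_range]
    have : (m : ℝ) ≤ ((K + m : ℕ) : ℝ) := by exact_mod_cast Nat.le_add_left _ _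
    gcongr
  have hsp : 0 < √((K + m : ℕ) : ℝ) := Real.sqrt_pos.2 hn0
  have hB' : (√((K + m : ℕ) : ℝ))⁻¹ * ∑ k ∈ Finset.range m, c (K + k) ≤ ε / 2 := by
    rwa [inv_mul_le_iff₀ hsp]
  linarith

/-- The diagonal cuts row i into two stretches. After folding by evenness, each runs over distinct
lags in {0, …, n − 1}, hence the factor 2. -/
lemma sum_truncatedCov_le (hθ : θ ∈ Ioo (0 : ℝ) 1) (h0 : ∀ k, 0 ≤ ρ k) (h1 : ∀ k, ρ k ≤ 1)
    (heven : ∀ k, ρ (-k) = ρ k) {n i : ℕ} (hi : i < n) :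
    ∑ j ∈ Finset.range n, |truncatedCov θ ρ (i + 1) (j + 1)|
      ≤ 2 * ∑ k ∈ Finset.range n, filteredCov θ ρ k := by
  have hR0 := filteredCov_nonneg hθ h0
  have hle : ∀ j : ℕ, |truncatedCov θ ρ (i + 1) (j + 1)| ≤ filteredCov θ ρ ((j : ℤ) - i) := by
    intro j
    rw [abs_of_nonneg (truncatedCov_nonneg hθ h0 _ _)]
    have := truncatedCov_le hθ h0 h1 (i + 1) (j + 1)
    rwa [show ((j + 1 : ℕ) : ℤ) - ((i + 1 : ℕ) : ℤ) = j - i by push_cast; ring] at this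
  refine (Finset.sum_le_sum fun j _ => hle j).trans ?_
  obtain ⟨m, rfl⟩ := Nat.exists_eq_add_of_le hi.le
  have hmono : ∀ a b : ℕ, a ≤ b → ∑ k ∈ Finset.range a, filteredCov θ ρ k
      ≤ ∑ k ∈ Finset.range b, filteredCov θ ρ k := fun a b hab =>
    Finset.sum_le_sum_of_subset_of_nonneg (Finset.range_mono hab) fun k _ _ => hR0 _
  rw [Finset.sum_range_add, two_mul]
  refine add_le_add ?_ ?_
  · rw [← Finset.sum_range_reflect]
    have e : ∀ j ∈ Finset.range i, filteredCov θ ρ (((i - 1 - j : ℕ) : ℤ) - i)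
        = filteredCov θ ρ ((j + 1 : ℕ) : ℤ) := by
      intro j hj
      rw [Finset.mem_range] at hj
      rw [← filteredCov_neg heven]
      congr 1; omega
    rw [Finset.sum_congr rfl e]
    refine le_trans ?_ (hmono (i + 1) (i + m) hi)
    rw [Finset.sum_range_succ' _ i]
    linarith [hR0 ((0 : ℕ) : ℤ)]
  · refine le_trans (le_of_eq ?_) (hmono m (i + m) (Nat.le_add_left _ _))
    refine Finset.sum_congr rfl fun j _ => ?_
    congr 1; push_cast; ring

/-- The variance deficit caused by the zero start decays like θ^i, so it sums to a bounded amount.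
-/
lemma tendsto_trace_bias (hθ : θ ∈ Ioo (0 : ℝ) 1) (h0 : ∀ k, 0 ≤ ρ k) (h1 : ∀ k, ρ k ≤ 1) :
    Tendsto (fun n : ℕ => (√(n : ℝ))⁻¹ *
      (∑ i ∈ Finset.range n, truncatedCov θ ρ (i + 1) (i + 1) - n * filteredCov θ ρ 0))
      atTop (𝓝 0) := by
  set C : ℝ := (1 - θ)⁻¹ * (1 - θ)⁻¹ with hC
  have hC0 : 0 ≤ C := mul_self_nonneg _
  have hg := summable_geometric_of_lt_one hθ.1.le hθ.2
  have hinv : Tendsto (fun n : ℕ => (√(n : ℝ))⁻¹ * (2 * C * ∑' k : ℕ, θ ^ k)) atTop (𝓝 0) := by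
    simpa using (tendsto_inv_atTop_zero.comp
      (Real.tendsto_sqrt_atTop.comp tendsto_natCast_atTop_atTop)).mul_const (2 * C * ∑' k : ℕ, θ ^ k)
  refine squeeze_zero_norm (fun n => ?_) hinv
  rw [norm_mul, norm_inv, Real.norm_of_nonneg (Real.sqrt_nonneg _)]
  gcongr
  have e : ∑ i ∈ Finset.range n, truncatedCov θ ρ (i + 1) (i + 1) - n * filteredCov θ ρ 0
      = -∑ i ∈ Finset.range n, (filteredCov θ ρ 0 - truncatedCov θ ρ (i + 1) (i + 1)) := by
    rw [Finset.sum_sub_distrib]; simp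
  have hup : ∀ i : ℕ, filteredCov θ ρ 0 - truncatedCov θ ρ (i + 1) (i + 1) ≤ 2 * C * θ ^ i := by
    intro i
    have := filteredCov_sub_truncatedCov_le hθ h0 h1 (i + 1) (i + 1)
    rw [sub_self] at this
    have hpow : θ ^ (i + 1) ≤ θ ^ i := pow_le_pow_of_le_one hθ.1.le hθ.2.le (Nat.le_succ i)
    nlinarith
  have hlow : ∀ i : ℕ, 0 ≤ filteredCov θ ρ 0 - truncatedCov θ ρ (i + 1) (i + 1) := by
    intro i
    have := truncatedCov_le hθ h0 h1 (i + 1) (i + 1)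
    rw [sub_self] at this
    linarith
  rw [e, norm_neg, Real.norm_of_nonneg (Finset.sum_nonneg fun i _ => hlow i)]
  calc _ ≤ ∑ i ∈ Finset.range n, 2 * C * θ ^ i := Finset.sum_le_sum fun i _ => hup i
    _ = 2 * C * ∑ i ∈ Finset.range n, θ ^ i := by rw [Finset.mul_sum]
    _ ≤ _ := by
      gcongr
      exact hg.sum_le_tsum _ fun i _ => pow_nonneg hθ.1.le _

end Covariance

/-! ### The noise, its linear filters and their second moments -/

lemma arProcess_eq_sum {Ω : Type*} (θ : ℝ) (ξ : ℤ → Ω → ℝ) (t : ℕ) (ω : Ω) :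
    arProcess θ ξ t ω = ∑ i ∈ Finset.range t, θ ^ i * ξ ((t : ℤ) - i) ω := by
  induction t with
  | zero => rfl
  | succ t ih =>
    change θ * arProcess θ ξ t ω + ξ ((t : ℤ) + 1) ω = _
    rw [ih, Finset.sum_range_succ', Finset.mul_sum]
    congr 1
    · refine Finset.sum_congr rfl fun i _ => ?_
      push_cast
      rw [add_sub_add_right_eq_sub]
      ring
    · simp

section Noise

variable {Ω : Type*} [MeasurableSpace Ω] {P : Measure Ω} {ξ : ℤ → Ω → ℝ}

lemma IsStationaryGaussian.memLp_two (hξ : IsStationaryGaussian P ξ) (t : ℤ) : MemLp (ξ t) 2 P :=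
  (hξ.gaussian.hasGaussianLaw_eval t).memLp_two

lemma IsStationaryGaussian.integrable_mul (hξ : IsStationaryGaussian P ξ) (s t : ℤ) :
    Integrable (fun ω => ξ s ω * ξ t ω) P :=
  (hξ.memLp_two s).integrable_mul (hξ.memLp_two t)

lemma IsStationaryGaussian.autocov_neg (hξ : IsStationaryGaussian P ξ) (k : ℤ) :
    autocov P ξ (-k) = autocov P ξ k := by
  have h := hξ.stationary k 0
  rw [zero_sub] at h
  rw [← h, autocov]
  simp_rw [mul_comm]

lemma IsStationaryGaussian.integral_norm_mul_le (hξ : IsStationaryGaussian P ξ)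
    (h1 : autocov P ξ 0 = 1) (s t : ℤ) : ∫ ω, ‖ξ s ω * ξ t ω‖ ∂P ≤ 1 := by
  have hs := hξ.stationary s s
  have ht := hξ.stationary t t
  rw [sub_self, h1] at hs ht
  have is := hξ.integrable_mul s s
  have it := hξ.integrable_mul t t
  calc ∫ ω, ‖ξ s ω * ξ t ω‖ ∂P ≤ ∫ ω, (1 / 2) * (ξ s ω * ξ s ω + ξ t ω * ξ t ω) ∂P := by
        refine integral_mono (hξ.integrable_mul s t).norm ((is.add it).const_mul _) fun ω => ?_
        simp only [Real.norm_eq_abs, abs_mul]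
        nlinarith [sq_nonneg (|ξ s ω| - |ξ t ω|), abs_mul_abs_self (ξ s ω), abs_mul_abs_self (ξ t ω)]
    _ = 1 := by
        rw [integral_const_mul, integral_add is it, hs, ht]; norm_num

lemma IsStationaryGaussian.autocov_le_one (hξ : IsStationaryGaussian P ξ)
    (h1 : autocov P ξ 0 = 1) (k : ℤ) : autocov P ξ k ≤ 1 :=
  (le_abs_self _).trans <| (norm_integral_le_integral_norm _).trans
    (hξ.integral_norm_mul_le h1 0 k)

lemma LongMemory.pos {H : ℝ} {L : ℝ → ℝ} {ρ : ℤ → ℝ} (h : LongMemory H L ρ) (k : ℤ) : 0 < ρ k := by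
  rcases eq_or_ne k 0 with rfl | hk
  · rw [h.cov_zero]; exact one_pos
  · have : (0 : ℝ) < |(k : ℝ)| := abs_pos.2 (Int.cast_ne_zero.2 hk)
    rw [h.cov_eq k hk]
    exact mul_pos (h.slowlyVarying.pos _ this) (Real.rpow_pos_of_pos this _)

lemma LongMemory.summable_sq {H : ℝ} {L : ℝ → ℝ} {ρ : ℤ → ℝ} (h : LongMemory H L ρ)
    (hH : H < 3 / 4) (heven : ∀ k, ρ (-k) = ρ k) : Summable fun k => ρ k ^ 2 := by
  suffices hnat : Summable fun k : ℕ => ρ k ^ 2 from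
    Summable.of_nat_of_neg hnat (by simpa only [heven] using hnat)
  -- With L(k) ≤ C k^δ, the bound on ρ(k)² has exponent 2δ + 4H − 4 = 2H − 5/2, below −1 exactly
  -- when H < 3/4.
  set δ : ℝ := (3 - 4 * H) / 4 with hδ
  have hδ0 : 0 < δ := by rw [hδ]; linarith
  obtain ⟨x₀, hx₀, hanti⟩ := h.slowlyVarying.antitone δ hδ0
  set C : ℝ := (x₀ + 1) ^ (-δ) * L (x₀ + 1)
  have hp : Summable fun k : ℕ => C ^ 2 * (k : ℝ) ^ (2 * H - 5 / 2) :=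
    (Real.summable_nat_rpow.2 (by linarith)).mul_left _
  refine hp.of_norm_bounded_eventually_nat ?_
  filter_upwards [eventually_ge_atTop (⌈x₀ + 1⌉₊)] with k hk
  have hk1 : x₀ + 1 ≤ k := (Nat.le_ceil _).trans (by exact_mod_cast hk)
  have hk0 : (0 : ℝ) < k := by linarith
  have hL : (k : ℝ) ^ (-δ) * L k ≤ C :=
    hanti (mem_Ioi.2 (by linarith)) (mem_Ioi.2 (by linarith)) hk1
  have hLpos := h.slowlyVarying.pos k hk0
  have hne : (k : ℤ) ≠ 0 := by exact_mod_cast hk0.ne'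
  have hρ : ρ k = ((k : ℝ) ^ (-δ) * L k) * (k : ℝ) ^ (δ + (2 * H - 2)) := by
    rw [h.cov_eq k hne, Int.cast_natCast, abs_of_pos hk0, Real.rpow_add hk0, Real.rpow_neg hk0.le]
    have := Real.rpow_pos_of_pos hk0 δ
    field_simp
  have hn : 0 ≤ (k : ℝ) ^ (-δ) * L k := by positivity
  rw [Real.norm_of_nonneg (sq_nonneg _), hρ, mul_pow, ← Real.rpow_natCast (_ ^ _) 2,
    ← Real.rpow_mul hk0.le]
  have e : (δ + (2 * H - 2)) * ((2 : ℕ) : ℝ) = 2 * H - 5 / 2 := by rw [hδ]; push_cast; ring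
  rw [e]
  gcongr

/-- E|ξ_s| ≤ 1 + E ξ_s² = 2, so the series of absolute values has finite expectation. -/
lemma IsStationaryGaussian.ae_summable_filter (hξ : IsStationaryGaussian P ξ)
    (h1 : autocov P ξ 0 = 1) {x : ℝ} (hx : x ∈ Ioo (0 : ℝ) 1) (t : ℤ) :
    ∀ᵐ ω ∂P, Summable fun j : ℕ => ‖x ^ j * ξ (t - j) ω‖ := by
  have hg := summable_geometric_of_lt_one hx.1.le hx.2
  have hprob := hξ.gaussian.isProbabilityMeasure
  have hint : ∀ s, ∫⁻ ω, ‖ξ s ω‖ₑ ∂P ≤ 2 := by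
    intro s
    have i1 : Integrable (ξ s) P := (hξ.memLp_two s).integrable (by norm_num)
    have hle : ∫ ω, ‖ξ s ω‖ ∂P ≤ 2 := by
      have hs := hξ.stationary s s
      rw [sub_self, h1] at hs
      calc ∫ ω, ‖ξ s ω‖ ∂P ≤ ∫ ω, (1 + ξ s ω * ξ s ω) ∂P := by
            refine integral_mono i1.norm ((integrable_const _).add (hξ.integrable_mul s s))
              fun ω => ?_
            simp only [Real.norm_eq_abs]
            nlinarith [sq_nonneg (|ξ s ω| - 1), abs_mul_abs_self (ξ s ω)]
        _ = 2 := by rw [integral_add (integrable_const _) (hξ.integrable_mul s s), hs]; simp; norm_num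
    rw [← ofReal_integral_norm_eq_lintegral_enorm i1]
    exact (ENNReal.ofReal_le_ofReal hle).trans (by simp)
  have hmeas : ∀ j : ℕ, AEMeasurable (fun ω => ‖x ^ j * ξ (t - j) ω‖ₑ) P := fun j =>
    ((hξ.gaussian.aemeasurable _).const_mul _).enorm
  have hfin : ∫⁻ ω, ∑' j : ℕ, ‖x ^ j * ξ (t - j) ω‖ₑ ∂P ≠ ⊤ := by
    rw [lintegral_tsum hmeas]
    have hb : ∀ j : ℕ, ∫⁻ ω, ‖x ^ j * ξ (t - j) ω‖ₑ ∂P ≤ ENNReal.ofReal (x ^ j) * 2 := by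
      intro j
      simp_rw [enorm_mul]
      rw [lintegral_const_mul'' _ (hξ.gaussian.aemeasurable _).enorm,
        Real.enorm_of_nonneg (pow_nonneg hx.1.le _)]
      gcongr
      exact hint _
    refine ne_top_of_le_ne_top ?_ (ENNReal.tsum_le_tsum hb)
    rw [ENNReal.tsum_mul_right, ← ENNReal.ofReal_tsum_of_nonneg (fun j => pow_nonneg hx.1.le _) hg]
    exact ENNReal.mul_ne_top ENNReal.ofReal_ne_top (by simp)
  filter_upwards [ae_lt_top' (AEMeasurable.tsum hmeas) hfin] with ω hω
  have := ENNReal.summable_toReal hω.ne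
  simpa using this

/-- The covariance of the stationary solution. -/
lemma IsStationaryGaussian.integral_stationarySolution_mul (hξ : IsStationaryGaussian P ξ)
    (h1 : autocov P ξ 0 = 1) {x : ℝ} (hx : x ∈ Ioo (0 : ℝ) 1) (k : ℤ) :
    ∫ ω, stationarySolution x ξ 0 ω * stationarySolution x ξ k ω ∂P
      = filteredCov x (autocov P ξ) k := by
  let F : ℕ × ℕ → Ω → ℝ := fun p ω => (x ^ p.1 * ξ (0 - p.1) ω) * (x ^ p.2 * ξ (k - p.2) ω)
  have hF : ∀ p ω, F p ω = (x ^ p.1 * x ^ p.2) * (ξ (0 - p.1) ω * ξ (k - p.2) ω) :=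
    fun p ω => by simp only [F]; ring
  have hFint : ∀ p, Integrable (F p) P := fun p => by
    simp_rw [funext (hF p)]
    exact (hξ.integrable_mul _ _).const_mul _
  -- Summable L¹ norms allow the expectation to be taken term by term in the double series.
  have hFn : Summable fun p => ∫ ω, ‖F p ω‖ ∂P := by
    refine (hasSum_geometric_prod hx).summable.of_nonneg_of_le
      (fun p => integral_nonneg fun ω => norm_nonneg _) fun p => ?_
    simp_rw [hF, norm_mul (x ^ p.1 * x ^ p.2), Real.norm_of_nonneg (geometric_prod_nonneg hx p)]
    rw [integral_const_mul]
    exact mul_le_of_le_one_right (geometric_prod_nonneg hx p) (hξ.integral_norm_mul_le h1 _ _)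
  have hsum := integral_tsum_of_summable_integral_norm hFint hFn
  have hae : ∀ᵐ ω ∂P, stationarySolution x ξ 0 ω * stationarySolution x ξ k ω = ∑' p, F p ω := by
    filter_upwards [hξ.ae_summable_filter h1 hx 0, hξ.ae_summable_filter h1 hx k] with ω h0 hk
    exact tsum_mul_tsum_of_summable_norm h0 hk
  rw [integral_congr_ae hae, ← hsum, filteredCov]
  refine tsum_congr fun p => ?_
  simp_rw [hF]
  rw [integral_const_mul, hξ.stationary]
  congr 2
  ring

lemma IsStationaryGaussian.autocov_stationarySolution (hξ : IsStationaryGaussian P ξ)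
    (h1 : autocov P ξ 0 = 1) {x : ℝ} (hx : x ∈ Ioo (0 : ℝ) 1) :
    autocov P (stationarySolution x ξ) = filteredCov x (autocov P ξ) :=
  funext fun k => hξ.integral_stationarySolution_mul h1 hx k

lemma IsStationaryGaussian.secondMoment_eq (hξ : IsStationaryGaussian P ξ)
    (h1 : autocov P ξ 0 = 1) {x : ℝ} (hx : x ∈ Ioo (0 : ℝ) 1) :
    secondMoment P ξ x = filteredCov x (autocov P ξ) 0 := by
  rw [← hξ.integral_stationarySolution_mul h1 hx 0, secondMoment]
  simp_rw [sq]

lemma IsStationaryGaussian.isGaussianProcess_arProcess (hξ : IsStationaryGaussian P ξ) (θ : ℝ) :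
    IsGaussianProcess (arProcess θ ξ) P := by
  classical
  refine hξ.gaussian.of_isGaussianProcess fun t =>
    ⟨(Finset.range t).image fun i : ℕ => (t : ℤ) - i,
      ∑ i : Finset.range t, θ ^ (i : ℕ) • ContinuousLinearMap.proj
        ⟨(t : ℤ) - (i : ℕ), Finset.mem_image_of_mem (fun i : ℕ => (t : ℤ) - i) i.2⟩, fun ω => ?_⟩
  rw [arProcess_eq_sum, ← Finset.sum_coe_sort]
  simp

lemma IsStationaryGaussian.integral_arProcess (hξ : IsStationaryGaussian P ξ) (θ : ℝ) (t : ℕ) :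
    ∫ ω, arProcess θ ξ t ω ∂P = 0 := by
  have := hξ.gaussian.isProbabilityMeasure
  simp_rw [arProcess_eq_sum]
  rw [integral_finsetSum _ fun i _ => ((hξ.memLp_two _).integrable (by norm_num)).const_mul _]
  simp [integral_const_mul, hξ.mean_zero]

lemma IsStationaryGaussian.integral_arProcess_mul (hξ : IsStationaryGaussian P ξ) (θ : ℝ)
    (s t : ℕ) :
    ∫ ω, arProcess θ ξ s ω * arProcess θ ξ t ω ∂P = truncatedCov θ (autocov P ξ) s t := by
  have e : ∀ ω, arProcess θ ξ s ω * arProcess θ ξ t ω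
      = ∑ p ∈ Finset.range s ×ˢ Finset.range t,
        (θ ^ p.1 * θ ^ p.2) * (ξ ((s : ℤ) - p.1) ω * ξ ((t : ℤ) - p.2) ω) := by
    intro ω
    rw [arProcess_eq_sum, arProcess_eq_sum, Finset.sum_mul_sum, Finset.sum_product]
    exact Finset.sum_congr rfl fun i _ => Finset.sum_congr rfl fun j _ => by ring
  simp_rw [e]
  rw [integral_finsetSum _ fun p _ => (hξ.integrable_mul _ _).const_mul _, truncatedCov]
  refine Finset.sum_congr rfl fun p _ => ?_
  rw [integral_const_mul, hξ.stationary]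
  congr 2
  ring

lemma IsStationaryGaussian.hasGaussianLaw_arProcess (hξ : IsStationaryGaussian P ξ) (θ : ℝ)
    (n : ℕ) : HasGaussianLaw (fun ω (i : Fin n) => arProcess θ ξ (i + 1) ω) P := by
  have h := ((hξ.isGaussianProcess_arProcess θ).comp_right
    (fun i : Fin n => (i : ℕ) + 1)).hasGaussianLaw Finset.univ
  exact h.map_fun (ContinuousLinearMap.pi fun i : Fin n =>
    ContinuousLinearMap.proj (⟨i, Finset.mem_univ i⟩ : (Finset.univ : Finset (Fin n))))

end Noise

/-! ### Monotonicity and derivative of the second moment -/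

section Derivative

variable {ρ : ℤ → ℝ}

/-- Every term is nondecreasing in x; the term (1, 0), equal to x ρ(1), is strictly increasing. -/
lemma strictMonoOn_filteredCov (h0 : ∀ k, 0 < ρ k) (h1 : ∀ k, ρ k ≤ 1) :
    StrictMonoOn (fun x => filteredCov x ρ 0) (Ioo 0 1) := by
  intro x hx y hy hxy
  have hpow : ∀ n : ℕ, x ^ n ≤ y ^ n := fun n => pow_le_pow_left₀ hx.1.le hxy.le n
  refine Summable.tsum_lt_tsum (i := ((1, 0) : ℕ × ℕ)) (fun p => ?_) ?_
    (summable_filteredCov hx (fun k => (h0 k).le) h1 0)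
    (summable_filteredCov hy (fun k => (h0 k).le) h1 0)
  · refine mul_le_mul_of_nonneg_right ?_ (h0 _).le
    exact mul_le_mul (hpow _) (hpow _) (pow_nonneg hx.1.le _) (pow_nonneg hy.1.le _)
  · simpa using mul_lt_mul_of_pos_right hxy (h0 _)

/-- Termwise differentiation on (0, r) with x < r < 1, dominated by the derivatives at r. The term
(1, 0) contributes ρ(1) > 0. -/
lemma exists_hasDerivAt_filteredCov (h0 : ∀ k, 0 < ρ k) (h1 : ∀ k, ρ k ≤ 1) {x : ℝ}
    (hx : x ∈ Ioo (0 : ℝ) 1) :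
    ∃ f' > 0, HasDerivAt (fun x => filteredCov x ρ 0) f' x := by
  obtain ⟨r, hxr, hr1⟩ := exists_between hx.2
  have hr : r ∈ Ioo (0 : ℝ) 1 := ⟨hx.1.trans hxr, hr1⟩
  have hsum1 : Summable fun n : ℕ => ((n : ℝ) + 1) * r ^ n := by
    have ha := summable_pow_mul_geometric_of_norm_lt_one 1 (r := r)
      (by rw [Real.norm_of_nonneg hr.1.le]; exact hr.2)
    have hb := summable_geometric_of_lt_one hr.1.le hr.2
    refine (ha.add hb).congr fun n => by ring
  let D : ℕ × ℕ → ℝ → ℝ := fun p y => ((p.1 + p.2 : ℕ) : ℝ) * y ^ (p.1 + p.2 - 1)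
  -- From i + j ≤ (i + 1)(j + 1), the majorant factors into two convergent series; r⁻¹ accounts for
  -- the exponent i + j − 1.
  have hDle : ∀ p : ℕ × ℕ, D p r ≤ r⁻¹ * (((p.1 : ℝ) + 1) * r ^ p.1 * (((p.2 : ℝ) + 1) * r ^ p.2)) := by
    intro p
    have e : r⁻¹ * (((p.1 : ℝ) + 1) * r ^ p.1 * (((p.2 : ℝ) + 1) * r ^ p.2))
        = (((p.1 : ℝ) + 1) * ((p.2 : ℝ) + 1)) * (r⁻¹ * r ^ (p.1 + p.2)) := by rw [pow_add]; ring
    rw [e]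
    rcases Nat.eq_zero_or_pos (p.1 + p.2) with hz | hz
    · simp only [D, hz, Nat.cast_zero, zero_mul]
      have := hr.1
      positivity
    · have e2 : r⁻¹ * r ^ (p.1 + p.2) = r ^ (p.1 + p.2 - 1) := by
        obtain ⟨m, hm⟩ := Nat.exists_eq_succ_of_ne_zero hz.ne'
        rw [hm, Nat.succ_eq_add_one, Nat.add_sub_cancel, pow_succ]
        have := hr.1.ne'
        field_simp
      rw [e2]
      refine mul_le_mul_of_nonneg_right ?_ (pow_nonneg hr.1.le _)
      push_cast
      nlinarith [(Nat.cast_nonneg p.1 : (0 : ℝ) ≤ p.1), (Nat.cast_nonneg p.2 : (0 : ℝ) ≤ p.2),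
        mul_nonneg (Nat.cast_nonneg p.1 : (0 : ℝ) ≤ p.1) (Nat.cast_nonneg p.2 : (0 : ℝ) ≤ p.2)]
  have hD0 : ∀ p y, 0 ≤ y → 0 ≤ D p y := fun p y hy => by simp only [D]; positivity
  have hnn : ∀ n : ℕ, 0 ≤ ((n : ℝ) + 1) * r ^ n := fun n => by
    have := hr.1; positivity
  have hu : Summable fun p => D p r :=
    ((hsum1.mul_of_nonneg hsum1 hnn hnn).mul_left r⁻¹).of_nonneg_of_le (fun p => hD0 p r hr.1.le) hDle
  have hbd : ∀ p y, y ∈ Ioo 0 r → ‖D p y * ρ (0 + p.1 - p.2)‖ ≤ D p r := by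
    intro p y hy
    rw [norm_mul, Real.norm_of_nonneg (hD0 p y hy.1.le), Real.norm_of_nonneg (h0 _).le]
    refine (mul_le_of_le_one_right (hD0 p y hy.1.le) (h1 _)).trans ?_
    exact mul_le_mul_of_nonneg_left (pow_le_pow_left₀ hy.1.le hy.2.le _) (Nat.cast_nonneg _)
  have hderiv := hasDerivAt_tsum_of_isPreconnected (t := Ioo 0 r)
    (g := fun (p : ℕ × ℕ) y => y ^ p.1 * y ^ p.2 * ρ (0 + p.1 - p.2))
    (g' := fun p y => D p y * ρ (0 + p.1 - p.2)) (y₀ := x) (y := x) hu isOpen_Ioo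
    isPreconnected_Ioo (fun p y _ => by
      simp_rw [← pow_add]
      exact (hasDerivAt_pow _ y).mul_const _) hbd ⟨hx.1, hxr⟩
    (summable_filteredCov hx (fun k => (h0 k).le) h1 0) ⟨hx.1, hxr⟩
  refine ⟨_, ?_, hderiv⟩
  refine (Summable.of_norm_bounded hu fun p => hbd p x ⟨hx.1, hxr⟩).tsum_pos
    (fun p => mul_nonneg (hD0 p x hx.1.le) (h0 _).le) (1, 0) ?_
  simpa [D] using h0 _

end Derivative

/-! ### The inverse of an increasing function on (0, 1) -/

section Inverse

variable {f d : ℝ → ℝ}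

lemma inverseOnUnit_apply (hf : InjOn f (Ioo 0 1)) {x : ℝ} (hx : x ∈ Ioo (0 : ℝ) 1) :
    inverseOnUnit f d (f x) = x := by
  rw [inverseOnUnit, if_pos (mem_image_of_mem f hx)]
  exact hf.leftInvOn_invFunOn hx

/-- Continuous images of intervals are order-connected, hence measurable; this handles the part of
each preimage lying in the range of f. -/
lemma measurable_inverseOnUnit (hf : StrictMonoOn f (Ioo 0 1)) (hc : ContinuousOn f (Ioo 0 1))
    (hd : Measurable d) : Measurable (inverseOnUnit f d) := by
  have himage : ∀ a : ℝ, MeasurableSet (f '' (Ioo 0 1 ∩ Ioi a)) := fun a =>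
    (((ordConnected_Ioo.inter ordConnected_Ioi).isPreconnected.image f
      (hc.mono inter_subset_left)).ordConnected).measurableSet
  have hS : MeasurableSet (f '' Ioo 0 1) :=
    ((isPreconnected_Ioo.image f hc).ordConnected).measurableSet
  refine measurable_of_Ioi fun a => ?_
  have e : inverseOnUnit f d ⁻¹' Ioi a
      = f '' (Ioo 0 1 ∩ Ioi a) ∪ ((f '' Ioo 0 1)ᶜ ∩ d ⁻¹' Ioi a) := by
    ext y
    by_cases hy : y ∈ f '' Ioo 0 1
    · obtain ⟨x, hx, rfl⟩ := hy
      rw [mem_preimage, inverseOnUnit_apply hf.injOn hx]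
      constructor
      · exact fun h => Or.inl ⟨x, ⟨hx, h⟩, rfl⟩
      · rintro (⟨z, ⟨hz, hza⟩, hzx⟩ | ⟨hn, -⟩)
        · rwa [← hf.injOn hz hx hzx]
        · exact absurd (mem_image_of_mem f hx) hn
    · have hn : y ∉ f '' (Ioo 0 1 ∩ Ioi a) := fun h => hy (image_mono inter_subset_left h)
      simp only [mem_preimage, mem_union, mem_inter_iff, mem_compl_iff, hy, hn, inverseOnUnit,
        if_false, not_false_eq_true, true_and, false_or]
  rw [e]
  exact (himage a).union (hS.compl.inter (hd measurableSet_Ioi))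

lemma hasDerivAt_inverseOnUnit (hf : StrictMonoOn f (Ioo 0 1)) (hc : ContinuousOn f (Ioo 0 1))
    {x f' : ℝ} (hx : x ∈ Ioo (0 : ℝ) 1) (hf' : f' ≠ 0) (hder : HasDerivAt f f' x) :
    HasDerivAt (inverseOnUnit f d) f'⁻¹ (f x) := by
  -- By the intermediate value theorem a whole neighbourhood of f(x) is attained on [u, v], so the
  -- default `d` plays no role near f(x).
  have hnear : ∀ u v, 0 < u → u < x → x < v → v < 1 →
      ∀ᶠ y in 𝓝 (f x), ∃ z ∈ Icc u v, f z = y := by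
    intro u v hu hux hxv hv
    have hsub : Icc u v ⊆ Ioo 0 1 := fun z hz => ⟨hu.trans_le hz.1, hz.2.trans_lt hv⟩
    have hivt := intermediate_value_Icc (hux.trans hxv).le (hc.mono hsub)
    have h1 : f u < f x := hf ⟨hu, hux.trans hx.2⟩ hx hux
    have h2 : f x < f v := hf hx ⟨hx.1.trans hxv, hv⟩ hxv
    filter_upwards [Icc_mem_nhds h1 h2] with y hy
    exact hivt hy
  have hgx : inverseOnUnit f d (f x) = x := inverseOnUnit_apply hf.injOn hx
  refine HasDerivAt.of_local_left_inverse (f := f) ?_ (by rwa [hgx]) hf' ?_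
  · rw [ContinuousAt, hgx, tendsto_order]
    refine ⟨fun a ha => ?_, fun a ha => ?_⟩
    · obtain ⟨u, hu1, hu2⟩ := exists_between (max_lt ha hx.1)
      obtain ⟨v, hv1, hv2⟩ := exists_between hx.2
      have hu0 : 0 < u := (le_max_right _ _).trans_lt hu1
      filter_upwards [hnear u v hu0 hu2 hv1 hv2] with y ⟨z, hz, hzy⟩
      rw [← hzy, inverseOnUnit_apply hf.injOn ⟨hu0.trans_le hz.1, hz.2.trans_lt hv2⟩]
      exact ((le_max_left _ _).trans_lt hu1).trans_le hz.1
    · obtain ⟨u, hu1, hu2⟩ := exists_between hx.1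
      obtain ⟨v, hv1, hv2⟩ := exists_between (lt_min ha hx.2)
      have hv3 : v < 1 := hv2.trans_le (min_le_right _ _)
      filter_upwards [hnear u v hu1 hu2 hv1 hv3] with y ⟨z, hz, hzy⟩
      rw [← hzy, inverseOnUnit_apply hf.injOn ⟨hu1.trans_le hz.1, hz.2.trans_lt hv3⟩]
      exact hz.2.trans_lt (hv2.trans_le (min_le_left _ _))
  · obtain ⟨u, hu1, hu2⟩ := exists_between hx.1
    obtain ⟨v, hv1, hv2⟩ := exists_between hx.2
    filter_upwards [hnear u v hu1 hu2 hv1 hv2] with y ⟨z, hz, hzy⟩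
    rw [← hzy, inverseOnUnit_apply hf.injOn ⟨hu1.trans_le hz.1, hz.2.trans_lt hv2⟩]

end Inverse

/-! ### Slutsky arguments and the delta method -/

lemma tendstoInMeasure_const_of_tendsto {Ω : Type*} [MeasurableSpace Ω] {P : Measure Ω}
    {a : ℕ → ℝ} {l : ℝ} (h : Tendsto a atTop (𝓝 l)) :
    TendstoInMeasure P (fun n _ => a n) atTop (fun _ => l) := by
  rw [tendstoInMeasure_iff_norm]
  intro ε hε
  refine tendsto_const_nhds.congr' ?_
  filter_upwards [(Metric.tendsto_nhds.1 h) ε hε] with n hn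
  rw [dist_eq_norm] at hn
  simp only [not_le.2 hn, ofPred_false, measure_empty]

section Delta

variable {Ω Ω' : Type*} [MeasurableSpace Ω] [MeasurableSpace Ω'] {P : Measure Ω}
  [IsProbabilityMeasure P] {μ : Measure Ω'} [IsProbabilityMeasure μ]

/-- Convergence in distribution to a constant implies convergence in probability. -/
lemma TendstoInDistribution.tendstoInMeasure_of_const {X : ℕ → Ω → ℝ} {c : ℝ}
    (h : TendstoInDistribution X atTop (fun _ : Ω' => c) (fun _ => P) μ) :
    TendstoInMeasure P X atTop (fun _ => c) := by
  rw [tendstoInMeasure_iff_norm]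
  intro ε hε
  -- Portmanteau for this closed set, which the constant limit does not charge.
  have hF : IsClosed {x : ℝ | ε ≤ ‖x - c‖} := isClosed_le continuous_const (by fun_prop)
  have hlim := ProbabilityMeasure.limsup_measure_closed_le_of_tendsto h.tendsto hF
  have h0 : (μ.map fun _ => c) {x : ℝ | ε ≤ ‖x - c‖} = 0 := by
    rw [Measure.map_apply measurable_const hF.measurableSet]
    simp [not_le.2 hε]
  simp only [ProbabilityMeasure.coe_mk, h0] at hlim
  have e : ∀ n, (P.map (X n)) {x : ℝ | ε ≤ ‖x - c‖} = P {ω | ε ≤ ‖X n ω - c‖} := fun n =>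
    Measure.map_apply_of_aemeasurable (h.forall_aemeasurable n) hF.measurableSet
  simp only [e] at hlim
  exact tendsto_of_le_liminf_of_limsup_le bot_le hlim

/-- Slutsky with the factor 1/√n gives convergence in law of T_n − a to 0, hence in probability. -/
lemma tendstoInMeasure_of_sqrt_mul_sub {T : ℕ → Ω → ℝ} {a : ℝ} {Z : Ω' → ℝ}
    (h : TendstoInDistribution (fun (n : ℕ) ω => √(n : ℝ) * (T n ω - a)) atTop Z (fun _ => P) μ) :
    TendstoInMeasure P T atTop (fun _ => a) := by
  have hinv : Tendsto (fun n : ℕ => (√(n : ℝ))⁻¹) atTop (𝓝 0) :=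
    tendsto_inv_atTop_zero.comp (Real.tendsto_sqrt_atTop.comp tendsto_natCast_atTop_atTop)
  have h1 := h.continuous_comp_prodMk_of_tendstoInMeasure_const
    (g := fun q : ℝ × ℝ => q.1 * q.2) (by fun_prop) (tendstoInMeasure_const_of_tendsto hinv)
    (fun n => aemeasurable_const)
  simp only [mul_zero] at h1
  have h2 := TendstoInDistribution.tendstoInMeasure_of_const h1
  rw [tendstoInMeasure_iff_norm] at h2 ⊢
  intro ε hε
  refine (h2 ε hε).congr' ?_
  filter_upwards [eventually_gt_atTop 0] with n hn
  have hs : √(n : ℝ) ≠ 0 := (Real.sqrt_pos.2 (by exact_mod_cast hn)).ne'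
  have e : ∀ ω, √(n : ℝ) * (T n ω - a) * (√(n : ℝ))⁻¹ = T n ω - a := fun ω => by field_simp
  simp only [e, sub_zero]

/-- The delta method, for a Gaussian limit. -/
theorem tendstoInDistribution_delta_method {T : ℕ → Ω → ℝ} (hT : ∀ n, AEMeasurable (T n) P)
    {a : ℝ} {v : NNReal}
    (h : TendstoInDistribution (fun (n : ℕ) ω => √(n : ℝ) * (T n ω - a)) atTop (id : ℝ → ℝ)
      (fun _ => P) (gaussianReal 0 v))
    {g : ℝ → ℝ} (hg : Measurable g) {g' : ℝ} (hder : HasDerivAt g g' a) :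
    TendstoInDistribution (fun (n : ℕ) ω => √(n : ℝ) * (g (T n ω) - g a)) atTop (id : ℝ → ℝ)
      (fun _ => P) (gaussianReal 0 ((g' ^ 2 * v).toNNReal)) := by
  have hTm := tendstoInMeasure_of_sqrt_mul_sub h
  -- The difference quotient completed at a makes g(T) − g(a) = (T − a)·`dslope g a T` hold even
  -- when T = a, and it is continuous at a. Slutsky then multiplies the limit by g'.
  have hmeas : Measurable (dslope g a) := by
    have : dslope g a = fun x => if x = a then deriv g a else (x - a)⁻¹ * (g x - g a) := by
      funext x
      split_ifs with hx
      · rw [hx, dslope_same]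
      · rw [dslope_of_ne _ hx, slope_def_field]; ring
    rw [this]
    exact Measurable.ite (measurableSet_singleton a) measurable_const (by fun_prop)
  have hcont : Tendsto (dslope g a) (𝓝 a) (𝓝 g') := by
    have := (continuousAt_dslope_same.2 hder.differentiableAt).tendsto
    rwa [dslope_same, hder.deriv] at this
  have hslope : TendstoInMeasure P (fun n ω => dslope g a (T n ω)) atTop (fun _ => g') := by
    rw [tendstoInMeasure_iff_norm] at hTm ⊢
    intro ε hε
    obtain ⟨δ, hδ, hδ'⟩ := Metric.tendsto_nhds_nhds.1 hcont ε hε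
    refine tendsto_of_tendsto_of_tendsto_of_le_of_le tendsto_const_nhds (hTm δ hδ)
      (fun n => bot_le) fun n => measure_mono fun ω hω => ?_
    by_contra hlt
    rw [mem_ofPred_eq, not_le, ← dist_eq_norm] at hlt
    have := hδ' hlt
    rw [dist_eq_norm] at this
    exact absurd hω (not_le.2 this)
  have key := h.continuous_comp_prodMk_of_tendstoInMeasure_const
    (g := fun q : ℝ × ℝ => q.1 * q.2) (by fun_prop) hslope
    (fun n => hmeas.comp_aemeasurable (hT n))
  have e : ∀ (n : ℕ) ω, √(n : ℝ) * (T n ω - a) * dslope g a (T n ω)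
      = √(n : ℝ) * (g (T n ω) - g a) := fun n ω => by
    rw [mul_assoc, ← smul_eq_mul (T n ω - a), sub_smul_dslope]
  simp only [e] at key
  have hlaw : (gaussianReal 0 v).map (fun ω => id ω * g')
      = (gaussianReal 0 ((g' ^ 2 * v).toNNReal)).map id := by
    have hv : NNReal.mk (g' ^ 2) (sq_nonneg _) * v = (g' ^ 2 * v).toNNReal :=
      NNReal.coe_injective
        (by rw [Real.coe_toNNReal _ (by positivity : 0 ≤ g' ^ 2 * (v : ℝ))]; rfl)
    simp only [Measure.map_id, id]
    rw [gaussianReal_map_mul_const, mul_zero, hv]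
  refine ⟨key.forall_aemeasurable, aemeasurable_id, ?_⟩
  have hlim : (⟨(gaussianReal 0 ((g' ^ 2 * v).toNNReal)).map id,
      Measure.isProbabilityMeasure_map aemeasurable_id⟩ : ProbabilityMeasure ℝ)
      = ⟨_, Measure.isProbabilityMeasure_map key.aemeasurable_limit⟩ := Subtype.ext hlaw.symm
  rw [hlim]
  exact key.tendsto

end Delta

/-! ### Assembly of the limit theorem -/

/-- The central limit theorem for the empirical second moment of the autoregressive process. -/
theorem tendstoInDistribution_secondMoment {Ω : Type*} [MeasurableSpace Ω] {P : Measure Ω}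
    [IsProbabilityMeasure P] {ξ : ℤ → Ω → ℝ} (hξ : IsStationaryGaussian P ξ)
    (h0 : ∀ k, 0 ≤ autocov P ξ k) (h1 : autocov P ξ 0 = 1)
    (hsq : Summable fun k => autocov P ξ k ^ 2) {θ : ℝ} (hθ : θ ∈ Ioo (0 : ℝ) 1) :
    TendstoInDistribution (fun (n : ℕ) ω => √(n : ℝ) *
      ((1 / (n : ℝ)) * ∑ t ∈ Finset.Icc 1 n, arProcess θ ξ t ω ^ 2 - secondMoment P ξ θ))
      atTop (id : ℝ → ℝ) (fun _ => P)
      (gaussianReal 0 (asymptoticVariance (autocov P (stationarySolution θ ξ))).toNNReal) := by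
  have hle := hξ.autocov_le_one h1
  have heven := hξ.autocov_neg
  have hRsq := summable_filteredCov_sq hθ h0 hle hsq
  have hclt := tendstoInDistribution_sum_sq (P := P)
    (X := fun n (i : Fin n) => arProcess θ ξ (i + 1))
    (fun n => hξ.hasGaussianLaw_arProcess θ n) (fun n i => hξ.integral_arProcess θ _)
    (G := fun n => Matrix.of fun i j : Fin n => truncatedCov θ (autocov P ξ) (i + 1) (j + 1))
    (fun n i j => hξ.integral_arProcess_mul θ _ _)
    (b := fun n => 2 * ∑ k ∈ Finset.range n, filteredCov θ (autocov P ξ) k)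
    (by
      have := (tendsto_inv_sqrt_mul_sum_of_summable_sq
        (fun k : ℕ => filteredCov_nonneg hθ h0 k)
        (hRsq.comp_injective (i := fun k : ℕ => (k : ℤ)) Nat.cast_injective)).const_mul 2
      rw [mul_zero] at this
      exact this.congr fun n => by ring)
    (fun n i => by
      simp only [Matrix.of_apply]
      rw [Fin.sum_univ_eq_sum_range
        (fun j => |truncatedCov θ (autocov P ξ) ((i : ℕ) + 1) (j + 1)|) n]
      exact sum_truncatedCov_le hθ h0 hle heven i.2)
    (S := ∑' k, filteredCov θ (autocov P ξ) k ^ 2)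
    ((tendsto_sum_truncatedCov_sq hθ h0 hle heven hsq).congr fun n => by
      simp only [Matrix.of_apply]
      rw [← Fin.sum_univ_eq_sum_range]
      congr 1
      refine Finset.sum_congr rfl fun i _ => ?_
      rw [Fin.sum_univ_eq_sum_range
        (fun j => truncatedCov θ (autocov P ξ) ((i : ℕ) + 1) (j + 1) ^ 2) n])
  have key := hclt.add_of_tendstoInMeasure_const
    (tendstoInMeasure_const_of_tendsto (tendsto_trace_bias hθ h0 hle))
    (fun n => aemeasurable_const)
  rw [asymptoticVariance, hξ.autocov_stationarySolution h1 hθ]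
  -- Centring at f(θ) = R(0) is centring at the trace plus the deterministic bias.
  have e : ∀ (n : ℕ), (fun ω => (√(n : ℝ))⁻¹ * (∑ i : Fin n, arProcess θ ξ (i + 1) ω ^ 2 -
        ∑ i : Fin n, truncatedCov θ (autocov P ξ) (i + 1) (i + 1))) + (fun _ => (√(n : ℝ))⁻¹ *
        (∑ i ∈ Finset.range n, truncatedCov θ (autocov P ξ) (i + 1) (i + 1)
          - n * filteredCov θ (autocov P ξ) 0))
      = fun ω => √(n : ℝ) *
      ((1 / (n : ℝ)) * ∑ t ∈ Finset.Icc 1 n, arProcess θ ξ t ω ^ 2 - secondMoment P ξ θ) := by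
    intro n
    funext ω
    rw [hξ.secondMoment_eq h1 hθ, Pi.add_apply,
      Fin.sum_univ_eq_sum_range (fun i => arProcess θ ξ (i + 1) ω ^ 2) n,
      Fin.sum_univ_eq_sum_range (fun i => truncatedCov θ (autocov P ξ) (i + 1) (i + 1)) n,
      show Finset.Icc 1 n = Finset.Ico (0 + 1) (n + 1) from rfl,
      ← Finset.sum_Ico_add' (fun t => arProcess θ ξ t ω ^ 2) 0 n 1, Nat.Ico_zero_eq_range]
    rcases Nat.eq_zero_or_pos n with rfl | hn
    · simp
    · have hn' : (0 : ℝ) < n := by exact_mod_cast hn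
      have hs : √(n : ℝ) ≠ 0 := (Real.sqrt_pos.2 hn').ne'
      have hss : √(n : ℝ) ^ 2 = n := Real.sq_sqrt hn'.le
      field_simp
      rw [hss]
      ring
  refine (key.congr (fun n => Eventually.of_forall fun ω => congrFun (e n) ω)
    (Eventually.of_forall fun ω => ?_))
  simp

end AR1

end

theorem theorem1p2 {Ω : Type*} [MeasurableSpace Ω] (P : Measure Ω) [IsProbabilityMeasure P]
    (ξ : ℤ → Ω → ℝ) (hξ : AR1.IsStationaryGaussian P ξ)
    (H : ℝ) (L : ℝ → ℝ) (hρ : AR1.LongMemory H L (AR1.autocov P ξ)) (hH : H < 3 / 4)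
    (θ : ℝ) (hθ : θ ∈ Ioo (0 : ℝ) 1) (d : ℝ → ℝ) (hd : Measurable d) :
    -- the inverse function, the derivative and the limiting variance are meaningful
    StrictMonoOn (AR1.secondMoment P ξ) (Ioo 0 1) ∧
    DifferentiableAt ℝ (AR1.secondMoment P ξ) θ ∧
    0 < deriv (AR1.secondMoment P ξ) θ ∧
    Summable (fun k : ℤ => (AR1.autocov P (AR1.stationarySolution θ ξ) k) ^ 2) ∧
    -- convergence in law
    TendstoInDistribution
      (fun (n : ℕ) ω =>
        √(n : ℝ) * (AR1.momentEstimator (AR1.secondMoment P ξ) d (AR1.arProcess θ ξ) n ω - θ))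
      atTop (id : ℝ → ℝ) (fun _ => P)
      (gaussianReal 0
        (AR1.asymptoticVariance (AR1.autocov P (AR1.stationarySolution θ ξ)) /
          (deriv (AR1.secondMoment P ξ) θ) ^ 2).toNNReal) := by
  have hpos := hρ.pos
  have h1 := hρ.cov_zero
  have hle := hξ.autocov_le_one h1
  have hsq := hρ.summable_sq hH hξ.autocov_neg
  -- The series formula is available only on (0, 1); since this interval is open, derivatives
  -- transfer.
  have heq : EqOn (fun x => AR1.filteredCov x (AR1.autocov P ξ) 0) (AR1.secondMoment P ξ)
      (Ioo 0 1) := fun x hx => (hξ.secondMoment_eq h1 hx).symm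
  have hmono : StrictMonoOn (AR1.secondMoment P ξ) (Ioo 0 1) :=
    (AR1.strictMonoOn_filteredCov hpos hle).congr heq
  have hder : ∀ x ∈ Ioo (0 : ℝ) 1, ∃ f' > 0, HasDerivAt (AR1.secondMoment P ξ) f' x := by
    intro x hx
    obtain ⟨f', hf', h⟩ := AR1.exists_hasDerivAt_filteredCov hpos hle hx
    exact ⟨f', hf', h.congr_of_eventuallyEq
      (heq.symm.eventuallyEq_of_mem (isOpen_Ioo.mem_nhds hx))⟩
  have hcont : ContinuousOn (AR1.secondMoment P ξ) (Ioo 0 1) := fun x hx => by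
    obtain ⟨f', -, h⟩ := hder x hx
    exact h.continuousAt.continuousWithinAt
  obtain ⟨f', hf', hf⟩ := hder θ hθ
  have hclt := AR1.tendstoInDistribution_secondMoment hξ (fun k => (hpos k).le) h1 hsq hθ
  refine ⟨hmono, hf.differentiableAt, hf.deriv ▸ hf', ?_, ?_⟩
  · rw [hξ.autocov_stationarySolution h1 hθ]
    exact AR1.summable_filteredCov_sq hθ (fun k => (hpos k).le) hle hsq
  · have hX : ∀ t, AEMeasurable (AR1.arProcess θ ξ t) P :=
      (hξ.isGaussianProcess_arProcess θ).aemeasurable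
    have key := AR1.tendstoInDistribution_delta_method (fun n => by fun_prop) hclt
      (AR1.measurable_inverseOnUnit hmono hcont hd)
      (AR1.hasDerivAt_inverseOnUnit hmono hcont hθ hf'.ne' hf)
    rw [AR1.inverseOnUnit_apply hmono.injOn hθ] at key
    have hV : 0 ≤ AR1.asymptoticVariance (AR1.autocov P (AR1.stationarySolution θ ξ)) :=
      mul_nonneg zero_le_two (tsum_nonneg fun k => sq_nonneg _)
    rw [Real.coe_toNNReal _ hV, inv_pow, ← div_eq_inv_mul, ← hf.deriv] at key
    exact key
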